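/- Let $PL_o(I)$ be the group, under composition, of orientation-preserving piecewise linear (with finitely many breakpoints) homeomorphisms of $I=[0,1]$. For a finitely generated group $\Gamma$ and a finite generating set $S$ of $\Gamma$, let $\mathrm{girth}(\Gamma,S)\in\mathbb{N}\cup\{\infty\}$ be the minimal length of a nonempty reduced word in the letters of $S$ and their formal inverses that represents the identity of $\Gamma$ (it is $\infty$ if there is no such word), and let $\mathrm{girth}(\Gamma)=\sup_S \mathrm{girth}(\Gamma,S)$, the supremum being over all finite generating sets $S$ of $\Gamma$. Theorem 1: every finitely generated subgroup $\Gamma$ of $PL_o(I)$ is solvable or satisfies $\mathrm{girth}(\Gamma)=\infty$. -/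

import Mathlib

/-- An orientation-preserving piecewise linear self-homeomorphism of `[0,1]`: it is strictly
increasing, and there is a finite set `P` of breakpoints such that it is affine on every closed
interval whose interior contains no point of `P`. -/
structure IsPLo (f : unitInterval ≃ₜ unitInterval) : Prop where
  strictMono : StrictMono f
  piecewise_affine : ∃ P : Finset unitInterval, ∀ u v : unitInterval, u < v →
    (∀ p ∈ P, p ∉ Set.Ioo u v) →
      ∃ a b : ℝ, ∀ z ∈ Set.Icc u v, ((f z : unitInterval) : ℝ) = a * (z : ℝ) + b

theorem IsPLo.one : IsPLo 1 :=
  ⟨fun _ _ h => h, ∅, fun _ _ _ _ => ⟨1, 0, fun z _ => by simp⟩⟩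

theorem IsPLo.mul {f g : unitInterval ≃ₜ unitInterval} (hf : IsPLo f) (hg : IsPLo g) :
    IsPLo (f * g) := by
  classical
  obtain ⟨P, hP⟩ := hf.piecewise_affine
  obtain ⟨Q, hQ⟩ := hg.piecewise_affine
  refine ⟨fun x y h => hf.strictMono (hg.strictMono h), Q ∪ P.image g.symm, fun u v huv h => ?_⟩
  obtain ⟨c, d, hcd⟩ := hQ u v huv fun p hp => h p (Finset.mem_union_left _ hp)
  obtain ⟨a, b, hab⟩ := hP (g u) (g v) (hg.strictMono huv) fun p hp hpm =>
    h (g.symm p) (Finset.mem_union_right _ (Finset.mem_image_of_mem _ hp))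
      ⟨hg.strictMono.lt_iff_lt.1 (by simpa using hpm.1),
        hg.strictMono.lt_iff_lt.1 (by simpa using hpm.2)⟩
  refine ⟨a * c, a * d + b, fun z hz => ?_⟩
  have h1 := hab (g z) ⟨hg.strictMono.monotone hz.1, hg.strictMono.monotone hz.2⟩
  rw [hcd z hz] at h1
  change ((f (g z) : unitInterval) : ℝ) = _
  rw [h1]
  ring

theorem IsPLo.inv {f : unitInterval ≃ₜ unitInterval} (hf : IsPLo f) : IsPLo f⁻¹ := by
  classical
  change IsPLo f.symm
  have hs : StrictMono f.symm := fun x y h => hf.strictMono.lt_iff_lt.1 (by simpa using h)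
  obtain ⟨P, hP⟩ := hf.piecewise_affine
  refine ⟨hs, P.image f, fun u v huv h => ?_⟩
  obtain ⟨a, b, hab⟩ := hP (f.symm u) (f.symm v) (hs huv) fun p hp hpm =>
    h (f p) (Finset.mem_image_of_mem _ hp)
      ⟨by simpa using hf.strictMono hpm.1, by simpa using hf.strictMono hpm.2⟩
  have key : ∀ z ∈ Set.Icc u v, (z : ℝ) = a * (f.symm z : ℝ) + b := fun z hz => by
    simpa using hab (f.symm z) ⟨hs.monotone hz.1, hs.monotone hz.2⟩
  have ha : a ≠ 0 := by
    rintro rfl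
    have h1 := key u ⟨le_rfl, huv.le⟩
    have h2 := key v ⟨huv.le, le_rfl⟩
    have h3 : (u : ℝ) < v := huv
    linarith
  refine ⟨a⁻¹, -(a⁻¹ * b), fun z hz => ?_⟩
  rw [key z hz]
  field_simp
  ring

/-- The group `PL_o(I)` of orientation-preserving piecewise linear homeomorphisms of `[0,1]`,
under composition. -/
def PLo : Subgroup (unitInterval ≃ₜ unitInterval) where
  carrier := {f | IsPLo f}
  one_mem' := IsPLo.one
  mul_mem' := IsPLo.mul
  inv_mem' := IsPLo.inv

open Classical in
/-- `girth(G, S)`: the minimal length of a relation among the elements of `S`, that is, of a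
nontrivial reduced word in the letters `S` and their formal inverses which evaluates to `1` in `G`
(`⊤` if there is no relation). -/
noncomputable def girthOn {G : Type*} [Group G] (S : Finset G) : ℕ∞ :=
  ⨅ (w : FreeGroup S) (_ : w ≠ 1) (_ : FreeGroup.lift (fun s : S => (s : G)) w = 1),
    (w.norm : ℕ∞)

/-- `girth(G)`: the supremum of `girth(G, S)` over all finite generating sets `S` of `G`. -/
noncomputable def groupGirth (G : Type*) [Group G] : ℕ∞ :=
  ⨆ (S : Finset G) (_ : Subgroup.closure (S : Set G) = ⊤), girthOn S

/-!
The proof constructs, for a finitely generated nonsolvable `Γ` and every `N`, a generating set of `Γ`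
without relations of length at most `N`.

Germs of piecewise linear maps on one side of a fixed point are linear, so they commute. Hence near
a fixed point a finitely generated group is trivial or has no other fixed point, and by compactness
of `[0,1]` some orbital `(a, b)` of `Γ` (an interval between consecutive common fixed points) carries
a nonsolvable action (`exists_isOrbital_of_not_isSolvable`). For the same reason commutators have
compact support in the orbitals (`IsOrbital.exists_suppIn`). On the other hand, a compact part of an
orbital is displaced from itself by some element of the group (`IsOrbital.exists_lt_smul`).

Both facts are used through one mechanism: a letter may move a compact set `C` between disjoint sites
`T α • C`, and a product of conjugates may act on each of these sites independently. Then a word acts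
on `C` as another word, which is read along the path of sites it visits (`lift_smul_eq_readWord`).

* A group of large derived length satisfies no short law (`exists_lift_smul_ne`). Let the first letter
  of a word displace a compact set. If the path closes up, the word that is read is shorter, and is
  nontrivial because the wreath product construction loses no information
  (`mk_eq_one_of_readWord_eq`); it is evaluated in the commutator subgroup by induction. Otherwise
  the word has a nonzero exponent sum in its first letter.
* Near `b`, take `t` and `x j = s j * t ^ p j` in `Γ`, where the `s j` generate `Γ` and the slopes at
  `b` are generic. They act as commuting maps, so the sites are indexed by `ℤ × (J → ℤ)`
  (`IsOrbital.exists_sites`). Let `u` act on these sites by independent elements `η α`. The elements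
  `t` and `z j = x j * t ^ M j * u * t ^ (-M j)` generate `Γ` if one of the `s j` is `1`. If the `M j`
  are far apart, a short word in them either moves `C` to another site or reads a nontrivial word in
  the `η α` (`latticeRead_ne_one`). There are only finitely many short words, so the first part
  provides `η` for which none of them is trivial.
-/

open Set Filter Topology

/-! ### Reading words along a path of positions -/

section Reading

variable {σ V A G X : Type*}

/-- One step of reading a word. A state consists of a position in `A` and of the word read so far.
The letter `s` moves the position by `d s` and reads `r s α` when it starts at position `α`; the
letter `s⁻¹` undoes this. -/
def readStep [AddGroup A] (d : σ → A) (r : σ → A → FreeGroup V) (p : σ × Bool)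
    (st : A × FreeGroup V) : A × FreeGroup V :=
  if p.2 then (st.1 + d p.1, r p.1 st.1 * st.2)
  else (st.1 - d p.1, (r p.1 (st.1 - d p.1))⁻¹ * st.2)

/-- The final position and the word read when the list of letters `L` is read from its last letter
to its first one (the order in which the letters act on a point), starting at position `α`. -/
def readWord [AddGroup A] (d : σ → A) (r : σ → A → FreeGroup V) (L : List (σ × Bool)) (α : A) :
    A × FreeGroup V :=
  L.foldr (readStep d r) (α, 1)

theorem readWord_cons [AddGroup A] (d : σ → A) (r : σ → A → FreeGroup V) (p : σ × Bool)
    (L : List (σ × Bool)) (α : A) :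
    readWord d r (p :: L) α = readStep d r p (readWord d r L α) := rfl

theorem norm_readWord_fst_le [SeminormedAddCommGroup A] {d : σ → A} (hd : ∀ s, ‖d s‖ ≤ 1)
    (r : σ → A → FreeGroup V) (α : A) (L : List (σ × Bool)) :
    ‖(readWord d r L α).1‖ ≤ ‖α‖ + L.length := by
  induction L with
  | nil => simp [readWord]
  | cons p L ih =>
    rw [readWord_cons, List.length_cons]
    push_cast
    unfold readStep
    split_ifs
    · have := norm_add_le (readWord d r L α).1 (d p.1)
      have := hd p.1
      dsimp only
      linarith
    · have := norm_sub_le (readWord d r L α).1 (d p.1)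
      have := hd p.1
      dsimp only
      linarith

/-- If every letter moves the site `T α • C` to `T (α + d s) • C` while acting inside it as the word
`r s α` evaluated at `η`, then a word acts on the site as the word that is read along its path of
positions. Only positions of norm at most `N` are required to behave in this way. -/
theorem lift_smul_eq_readWord [SeminormedAddCommGroup A] [Group G] [MulAction G X]
    {g : σ → G} {d : σ → A} {r : σ → A → FreeGroup V} {T : A → G} {η : V → G} {C : Set X} {N : ℝ}
    (hd : ∀ s, ‖d s‖ ≤ 1)
    (hC : ∀ w, ∀ z ∈ C, FreeGroup.lift η w • z ∈ C)
    (hg : ∀ s α, ‖α‖ ≤ N → ∀ z ∈ C,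
      g s • T α • z = T (α + d s) • FreeGroup.lift η (r s α) • z)
    (α : A) (L : List (σ × Bool)) (hL : ‖α‖ + L.length ≤ N) {z : X} (hz : z ∈ C) :
    FreeGroup.lift g (FreeGroup.mk L) • T α • z =
      T (readWord d r L α).1 • FreeGroup.lift η (readWord d r L α).2 • z := by
  induction L with
  | nil =>
    rw [← FreeGroup.one_eq_mk]
    simp [readWord]
  | cons p L ih =>
    have hL' : ‖α‖ + L.length ≤ N := by
      rw [List.length_cons] at hL
      push_cast at hL
      linarith
    have hN := norm_readWord_fst_le hd r α (p :: L)
    have hN' := norm_readWord_fst_le hd r α L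
    have hsplit : FreeGroup.mk (p :: L) = FreeGroup.mk [p] * FreeGroup.mk L := by
      rw [FreeGroup.mul_mk, List.singleton_append]
    rw [hsplit, map_mul, mul_smul, ih hL']
    rw [readWord_cons] at hN ⊢
    generalize readWord d r L α = st at *
    obtain ⟨β, R⟩ := st
    obtain ⟨s, e⟩ := p
    cases e
    · simp only [readStep, Bool.false_eq_true, if_false] at hN ⊢
      have h := hg s (β - d s) (hN.trans hL) _ (hC ((r s (β - d s))⁻¹ * R) z hz)
      rw [sub_add_cancel, ← mul_smul (FreeGroup.lift η (r s (β - d s))), ← map_mul,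
        mul_inv_cancel_left] at h
      rw [← h]
      simp [FreeGroup.lift_mk, ← mul_smul]
    · simp only [readStep, if_true] at hN ⊢
      have h := hg s β (hN'.trans hL') _ (hC R z hz)
      rw [map_mul, mul_smul, ← h]
      simp [FreeGroup.lift_mk, ← mul_smul]

/-- Letters reading nothing do not count for the length of the word that is read. -/
theorem norm_readWord_snd_le [AddGroup A] [DecidableEq V] [DecidableEq σ] {i : σ} (d : σ → A)
    {r : σ → A → FreeGroup V} (hi : ∀ α, r i α = 1) (hr : ∀ s α, (r s α).norm ≤ 1)
    (α : A) (L : List (σ × Bool)) :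
    (readWord d r L α).2.norm ≤ L.countP (fun p => p.1 ≠ i) := by
  induction L with
  | nil => simp [readWord]
  | cons p L ih =>
    rw [readWord_cons]
    unfold readStep
    by_cases hp : p.1 = i
    · rw [List.countP_cons_of_neg (by simp [hp])]
      simp only [hp, hi]
      split_ifs <;> simpa using ih
    · have h1 := FreeGroup.norm_mul_le (r p.1 (readWord d r L α).1) (readWord d r L α).2
      have h2 := FreeGroup.norm_mul_le (r p.1 ((readWord d r L α).1 - d p.1))⁻¹
        (readWord d r L α).2
      rw [FreeGroup.norm_inv_eq] at h2
      have h3 := hr p.1 (readWord d r L α).1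
      have h4 := hr p.1 ((readWord d r L α).1 - d p.1)
      rw [List.countP_cons_of_pos (by simp [hp])]
      split_ifs <;> dsimp only <;> omega

/-- Renaming the letters that are read commutes with reading. -/
theorem readWord_map [SeminormedAddCommGroup A] {W : Type*} (κ : V → W) {d : σ → A}
    {r : σ → A → FreeGroup V} {r' : σ → A → FreeGroup W} {N : ℝ} (hd : ∀ s, ‖d s‖ ≤ 1)
    (h : ∀ s α, ‖α‖ ≤ N → FreeGroup.map κ (r s α) = r' s α) (α : A) (L : List (σ × Bool))
    (hL : ‖α‖ + L.length ≤ N) :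
    (readWord d r' L α) = ((readWord d r L α).1, FreeGroup.map κ (readWord d r L α).2) := by
  induction L with
  | nil => simp [readWord]
  | cons p L ih =>
    have hN := norm_readWord_fst_le hd r α (p :: L)
    have hN' := norm_readWord_fst_le hd r α L
    have hL' : ‖α‖ + L.length ≤ N := by
      rw [List.length_cons] at hL
      push_cast at hL
      linarith
    rw [readWord_cons, ih hL']
    rw [readWord_cons] at hN ⊢
    unfold readStep at hN ⊢
    split_ifs with hp
    · simp [h _ _ (hN'.trans hL')]
    · rw [if_neg hp] at hN
      simp [h _ _ (hN.trans hL)]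

/-- Reading loses no information: let the letter `i` move by one step, let all other letters stay
in place, and let each of them read a letter that records it together with its position. Then a word
that returns to its starting position and reads the trivial word is trivial. Indeed, `(s, n)` can be
decoded as `i⁻ⁿ s iⁿ`. -/
theorem mk_eq_one_of_readWord_eq [SeminormedAddCommGroup A] (f : A →+ ℤ) {i : σ} {d : σ → A}
    {r : σ → A → FreeGroup (σ × ℤ)} (hd : ∀ s, ‖d s‖ ≤ 1) (hdi : f (d i) = 1)
    (hds : ∀ s, s ≠ i → f (d s) = 0) (hri : ∀ α, r i α = 1)
    (hrs : ∀ s, s ≠ i → ∀ α, r s α = FreeGroup.of (s, f α)) (α : A) (L : List (σ × Bool))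
    (hpos : f (readWord d r L α).1 = f α) (hread : (readWord d r L α).2 = 1) :
    FreeGroup.mk L = 1 := by
  have h := lift_smul_eq_readWord (G := FreeGroup σ) (X := FreeGroup σ) (g := FreeGroup.of)
    (T := fun α => FreeGroup.of i ^ f α) (r := r) (C := Set.univ) (N := ‖α‖ + L.length)
    (η := fun v => (FreeGroup.of i ^ v.2)⁻¹ * FreeGroup.of v.1 * FreeGroup.of i ^ v.2)
    hd (fun _ _ _ => mem_univ _) (fun s β _ z _ => by
      by_cases hs : s = i
      · subst hs
        rw [map_add, hdi, hri, map_one, one_smul, add_comm, zpow_one_add, mul_smul]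
      · rw [map_add, hds s hs, add_zero, hrs s hs, FreeGroup.lift_apply_of]
        simp only [smul_eq_mul]
        group) α L le_rfl (z := 1) (mem_univ _)
  rw [hread, hpos, map_one, one_smul, FreeGroup.lift_of_apply, smul_eq_mul, smul_eq_mul,
    mul_one] at h
  simpa using h

end Reading

/-! ### The action on the interval, orbitals and displacement -/

/-- `PL_o(I)` acts on `[0,1]` by evaluation. -/
instance : MulAction PLo unitInterval where
  smul g z := g.1 z
  one_smul _ := rfl
  mul_smul _ _ _ := rfl

theorem PLo.smul_def (g : PLo) (z : unitInterval) : g • z = g.1 z := rfl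

theorem PLo.smul_lt_smul_iff (g : PLo) {y z : unitInterval} : g • y < g • z ↔ y < z :=
  g.2.strictMono.lt_iff_lt

theorem PLo.smul_le_smul_iff (g : PLo) {y z : unitInterval} : g • y ≤ g • z ↔ y ≤ z :=
  g.2.strictMono.le_iff_le

theorem PLo.zpow_smul_ne (g : PLo) {z : unitInterval} (h : g • z ≠ z) {n : ℤ} (hn : n ≠ 0) :
    g ^ n • z ≠ z := by
  have hpow : ∀ k : ℕ, g ^ (k + 1) • z ≠ z := by
    intro k
    rcases lt_or_gt_of_ne h with h | h
    · refine ne_of_lt ?_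
      induction k with
      | zero => simpa using h
      | succ k ih =>
        rw [pow_succ, mul_smul]
        exact ((PLo.smul_lt_smul_iff _).2 h).trans ih
    · refine ne_of_gt ?_
      induction k with
      | zero => simpa using h
      | succ k ih =>
        rw [pow_succ, mul_smul]
        exact ih.trans ((PLo.smul_lt_smul_iff _).2 h)
  rcases Int.eq_nat_or_neg n with ⟨k, rfl | rfl⟩
  · obtain ⟨k, rfl⟩ := Nat.exists_eq_succ_of_ne_zero (n := k) (by simpa using hn)
    rw [zpow_natCast]
    exact hpow k
  · obtain ⟨k, rfl⟩ := Nat.exists_eq_succ_of_ne_zero (n := k) (by simpa using hn)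
    intro h'
    rw [zpow_neg, zpow_natCast, inv_smul_eq_iff] at h'
    exact hpow k h'.symm

/-- `(a, b)` is an orbital of the group `D`: its end points are fixed by `D`, but no point inside
is. -/
structure IsOrbital (D : Subgroup PLo) (a b : unitInterval) : Prop where
  lt : a < b
  left : ∀ g ∈ D, g • a = a
  right : ∀ g ∈ D, g • b = b
  moved : ∀ z ∈ Ioo a b, ∃ g ∈ D, g • z ≠ z

namespace IsOrbital

variable {D : Subgroup PLo} {a b : unitInterval}

theorem smul_mem (h : IsOrbital D a b) {g : PLo} (hg : g ∈ D) {z : unitInterval}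
    (hz : z ∈ Ioo a b) : g • z ∈ Ioo a b := by
  constructor
  · have := (PLo.smul_lt_smul_iff g).2 hz.1
    rwa [h.left g hg] at this
  · have := (PLo.smul_lt_smul_iff g).2 hz.2
    rwa [h.right g hg] at this

/-- The supremum of an orbit inside an orbital is fixed, so it is the right end point. -/
theorem exists_lt_smul (h : IsOrbital D a b) {c d : unitInterval} (hc : c ∈ Ioo a b)
    (hd : d ∈ Ioo a b) : ∃ g ∈ D, d < g • c := by
  by_contra! hle
  set m : unitInterval := sSup {y | ∃ g ∈ D, g • c = y} with hm
  have hmem : ∀ g ∈ D, g • c ≤ m := fun g hg => le_sSup ⟨g, hg, rfl⟩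
  have hmd : m ≤ d := sSup_le (by rintro _ ⟨g, hg, rfl⟩; exact hle g hg)
  have hcm : c ≤ m := by simpa using hmem 1 D.one_mem
  have hsub : ∀ g ∈ D, g • m ≤ m := by
    intro g hg
    by_contra! hlt
    have h1 : g⁻¹ • m < m := by
      rw [← PLo.smul_lt_smul_iff g, smul_inv_smul]
      exact hlt
    obtain ⟨_, ⟨k, hk, rfl⟩, hk'⟩ := lt_sSup_iff.1 h1
    have h2 := (PLo.smul_lt_smul_iff g).2 hk'
    rw [smul_inv_smul, ← mul_smul] at h2
    exact absurd (hmem _ (D.mul_mem hg hk)) (not_le.2 h2)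
  obtain ⟨g, hg, hgm⟩ := h.moved m ⟨hc.1.trans_le hcm, hmd.trans_lt hd.2⟩
  refine hgm (le_antisymm (hsub g hg) ?_)
  have := (PLo.smul_le_smul_iff g).2 (hsub _ (D.inv_mem hg))
  rwa [smul_inv_smul] at this

/-- Powers of an element that pushes an interval `[c, d]` above itself make it disjoint from
itself. -/
theorem zpow_smul_notMem {g : PLo} {c d : unitInterval} (hcd : d < g • c) {n : ℤ} (hn : n ≠ 0)
    {z : unitInterval} (hz : z ∈ Icc c d) : g ^ n • z ∉ Icc c d := by
  have hup : ∀ k : ℕ, ∀ y ∈ Icc c d, d < g ^ (k + 1) • y := by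
    intro k y hy
    have hone : d < g • y := hcd.trans_le ((PLo.smul_le_smul_iff g).2 hy.1)
    induction k with
    | zero => simpa using hone
    | succ k ih =>
      rw [pow_succ', mul_smul]
      have hcy : c ≤ g ^ (k + 1) • y := (hy.1.trans hy.2).trans ih.le
      exact hcd.trans_le ((PLo.smul_le_smul_iff g).2 hcy)
  intro hmem
  rcases Int.eq_nat_or_neg n with ⟨k, rfl | rfl⟩
  · obtain ⟨k, rfl⟩ := Nat.exists_eq_succ_of_ne_zero (n := k) (by simpa using hn)
    rw [zpow_natCast] at hmem
    exact absurd hmem.2 (not_le.2 (hup k z hz))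
  · obtain ⟨k, rfl⟩ := Nat.exists_eq_succ_of_ne_zero (n := k) (by simpa using hn)
    rw [zpow_neg, zpow_natCast] at hmem
    have := hup k _ hmem
    rw [smul_inv_smul] at this
    exact absurd hz.2 (not_le.2 this)

/-- A convex set without common fixed points lies in a single orbital. -/
theorem subset_of_ordConnected (h : IsOrbital D a b) {s : Set unitInterval} (hs : s.OrdConnected)
    (hmoved : ∀ z ∈ s, ∃ g ∈ D, g • z ≠ z) {y : unitInterval} (hy : y ∈ s) (hyab : y ∈ Ioo a b) :
    s ⊆ Ioo a b := by
  intro z hz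
  constructor
  · by_contra! hza
    obtain ⟨g, hg, hne⟩ := hmoved a (hs.out hz hy ⟨hza, hyab.1.le⟩)
    exact hne (h.left g hg)
  · by_contra! hza
    obtain ⟨g, hg, hne⟩ := hmoved b (hs.out hy hz ⟨hyab.2.le, hza⟩)
    exact hne (h.right g hg)

end IsOrbital

theorem PLo.continuous_smul (g : PLo) : Continuous fun z : unitInterval => g • z :=
  g.1.continuous

theorem PLo.smul_zero (g : PLo) : g • (0 : unitInterval) = 0 := by
  refine le_antisymm ?_ unitInterval.nonneg'
  have : g • (0 : unitInterval) ≤ g • g⁻¹ • (0 : unitInterval) :=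
    (PLo.smul_le_smul_iff g).2 unitInterval.nonneg'
  rwa [smul_inv_smul] at this

theorem PLo.smul_one' (g : PLo) : g • (1 : unitInterval) = 1 := by
  refine le_antisymm unitInterval.le_one' ?_
  have : g • g⁻¹ • (1 : unitInterval) ≤ g • (1 : unitInterval) :=
    (PLo.smul_le_smul_iff g).2 unitInterval.le_one'
  rwa [smul_inv_smul] at this

theorem exists_isOrbital {D : Subgroup PLo} {x : unitInterval} {g : PLo} (hg : g ∈ D)
    (hx : g • x ≠ x) : ∃ a b, IsOrbital D a b ∧ x ∈ Ioo a b := by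
  set F : Set unitInterval := {z | ∀ g ∈ D, g • z = z} with hF
  have hclosed : IsClosed F := by
    have : F = ⋂ g ∈ D, {z | g • z = z} := by ext; simp [hF]
    rw [this]
    exact isClosed_biInter fun g _ => isClosed_eq (PLo.continuous_smul g) continuous_id
  have hxF : x ∉ F := fun h => hx (h g hg)
  have ha := (hclosed.inter isClosed_Iic).sSup_mem (s := F ∩ Iic x)
    ⟨0, fun g _ => PLo.smul_zero g, unitInterval.nonneg'⟩
  have hb := (hclosed.inter isClosed_Ici).sInf_mem (s := F ∩ Ici x)
    ⟨1, fun g _ => PLo.smul_one' g, unitInterval.le_one'⟩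
  have hax : sSup (F ∩ Iic x) < x := lt_of_le_of_ne ha.2 fun h => hxF (h ▸ ha.1)
  have hxb : x < sInf (F ∩ Ici x) := lt_of_le_of_ne hb.2 fun h => hxF (h ▸ hb.1)
  refine ⟨_, _, ⟨hax.trans hxb, ha.1, hb.1, fun z hz => ?_⟩, hax, hxb⟩
  by_contra! hfix
  rcases le_total z x with h | h
  · exact absurd (le_sSup (a := z) (s := F ∩ Iic x) ⟨hfix, h⟩) (not_le.2 hz.1)
  · exact absurd (sInf_le (a := z) (s := F ∩ Ici x) ⟨hfix, h⟩) (not_le.2 hz.2)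

/-! ### Germs at a fixed point -/

/-- The map `g` is, along the filter `l`, the affine map with fixed point `p` and slope `c > 0`. -/
def HasGerm (l : Filter unitInterval) (p : unitInterval) (g : PLo) (c : ℝ) : Prop :=
  0 < c ∧ ∀ᶠ z in l, ((g • z : unitInterval) : ℝ) = p + c * (z - p)

/-- What is used of the filters `𝓝[<] p` and `𝓝[>] p`: they are nontrivial, avoid `p`, have a basis
of convex sets, and are preserved by the elements of `PL_o(I)` fixing `p`, which have germs along
them. -/
structure IsSide (l : Filter unitInterval) (p : unitInterval) : Prop where
  neBot : l.NeBot
  ne : ∀ᶠ z in l, z ≠ p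
  exists_ordConnected : ∀ s ∈ l, ∃ t ∈ l, t ⊆ s ∧ t.OrdConnected
  tendsto : ∀ g : PLo, g • p = p → Tendsto (fun z => g • z) l l
  germ : ∀ g : PLo, g • p = p → ∃ c, HasGerm l p g c

theorem isSide_left {a b : unitInterval} (hab : a < b) : IsSide (𝓝[<] b) b where
  neBot := nhdsLT_neBot_of_exists_lt ⟨a, hab⟩
  ne := by
    filter_upwards [self_mem_nhdsWithin] with z hz using ne_of_lt hz
  exists_ordConnected s hs := by
    obtain ⟨u, hu, hus⟩ := (mem_nhdsLT_iff_exists_mem_Ico_Ioo_subset hab).1 hs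
    exact ⟨_, Ioo_mem_nhdsLT hu.2, hus, ordConnected_Ioo⟩
  tendsto g hg := by
    refine tendsto_nhdsWithin_iff.2 ⟨?_, ?_⟩
    · have := (PLo.continuous_smul g).tendsto b
      rw [hg] at this
      exact this.mono_left nhdsWithin_le_nhds
    · filter_upwards [self_mem_nhdsWithin] with z hz
      have := (PLo.smul_lt_smul_iff g).2 hz
      rwa [hg] at this
  germ g hg := by
    obtain ⟨P, hP⟩ := g.2.piecewise_affine
    have hev : ∀ᶠ u in 𝓝[<] b, ∀ p ∈ P, p ∉ Ioo u b := by
      rw [eventually_all_finset]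
      intro p _
      rcases lt_or_ge p b with hp | hp
      · filter_upwards [nhdsWithin_le_nhds (Ioi_mem_nhds hp)] with u hu hpu
        exact absurd hu (not_lt.2 hpu.1.le)
      · exact Eventually.of_forall fun u hu => absurd hu.2 (not_lt.2 hp)
    have := nhdsLT_neBot_of_exists_lt ⟨a, hab⟩
    obtain ⟨u, hu, hub⟩ := (hev.and self_mem_nhdsWithin).exists
    obtain ⟨c, e, hce⟩ := hP u b hub hu
    have hb := hce b ⟨le_of_lt hub, le_rfl⟩
    have hu' := hce u ⟨le_rfl, le_of_lt hub⟩
    have hb' : (b : ℝ) = c * b + e := by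
      rw [← hb]
      exact congrArg _ hg.symm
    have hlt : ((g.1 u : unitInterval) : ℝ) < (g.1 b : unitInterval) := g.2.strictMono hub
    have hub' : (u : ℝ) < b := hub
    refine ⟨c, by nlinarith, ?_⟩
    filter_upwards [self_mem_nhdsWithin, nhdsWithin_le_nhds (Ioi_mem_nhds hub)] with z hz hz'
    rw [PLo.smul_def, hce z ⟨le_of_lt hz', le_of_lt hz⟩]
    linarith

theorem isSide_right {a b : unitInterval} (hab : a < b) : IsSide (𝓝[>] a) a where
  neBot := nhdsGT_neBot_of_exists_gt ⟨b, hab⟩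
  ne := by
    filter_upwards [self_mem_nhdsWithin] with z hz using ne_of_gt hz
  exists_ordConnected s hs := by
    obtain ⟨u, hu, hus⟩ := (mem_nhdsGT_iff_exists_mem_Ioc_Ioo_subset hab).1 hs
    exact ⟨_, Ioo_mem_nhdsGT hu.1, hus, ordConnected_Ioo⟩
  tendsto g hg := by
    refine tendsto_nhdsWithin_iff.2 ⟨?_, ?_⟩
    · have := (PLo.continuous_smul g).tendsto a
      rw [hg] at this
      exact this.mono_left nhdsWithin_le_nhds
    · filter_upwards [self_mem_nhdsWithin] with z hz
      have := (PLo.smul_lt_smul_iff g).2 hz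
      rwa [hg] at this
  germ g hg := by
    obtain ⟨P, hP⟩ := g.2.piecewise_affine
    have hev : ∀ᶠ u in 𝓝[>] a, ∀ p ∈ P, p ∉ Ioo a u := by
      rw [eventually_all_finset]
      intro p _
      rcases lt_or_ge a p with hp | hp
      · filter_upwards [nhdsWithin_le_nhds (Iio_mem_nhds hp)] with u hu hpu
        exact absurd hu (not_lt.2 hpu.2.le)
      · exact Eventually.of_forall fun u hu => absurd hu.1 (not_lt.2 hp)
    have := nhdsGT_neBot_of_exists_gt ⟨b, hab⟩
    obtain ⟨u, hu, hau⟩ := (hev.and self_mem_nhdsWithin).exists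
    obtain ⟨c, e, hce⟩ := hP a u hau hu
    have ha := hce a ⟨le_rfl, le_of_lt hau⟩
    have hu' := hce u ⟨le_of_lt hau, le_rfl⟩
    have ha' : (a : ℝ) = c * a + e := by
      rw [← ha]
      exact congrArg _ hg.symm
    have hlt : ((g.1 a : unitInterval) : ℝ) < (g.1 u : unitInterval) := g.2.strictMono hau
    have hau' : (a : ℝ) < u := hau
    refine ⟨c, by nlinarith, ?_⟩
    filter_upwards [self_mem_nhdsWithin, nhdsWithin_le_nhds (Iio_mem_nhds hau)] with z hz hz'
    rw [PLo.smul_def, hce z ⟨le_of_lt hz, le_of_lt hz'⟩]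
    linarith

namespace IsSide

variable {l : Filter unitInterval} {p : unitInterval}

theorem germ_unique (h : IsSide l p) {g : PLo} {c c' : ℝ} (hc : HasGerm l p g c)
    (hc' : HasGerm l p g c') : c = c' := by
  have := h.neBot
  obtain ⟨z, hz, h1, h2⟩ := (h.ne.and (hc.2.and hc'.2)).exists
  have hzp : (z : ℝ) - p ≠ 0 := sub_ne_zero.2 fun h => hz (Subtype.ext h)
  exact mul_right_cancel₀ hzp (by linarith)

theorem germ_mul (h : IsSide l p) {g k : PLo} (hk : k • p = p) {c c' : ℝ}
    (hc : HasGerm l p g c) (hc' : HasGerm l p k c') : HasGerm l p (g * k) (c * c') := by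
  refine ⟨mul_pos hc.1 hc'.1, ?_⟩
  filter_upwards [hc'.2, (h.tendsto k hk).eventually hc.2] with z h1 h2
  rw [mul_smul, h2, h1]
  ring

/-- The logarithm of the slope at `p`, on a given side, as a homomorphism from the stabilizer
of `p`. -/
noncomputable def logSlope (h : IsSide l p) :
    MulAction.stabilizer PLo p →* Multiplicative ℝ where
  toFun g := Multiplicative.ofAdd (Real.log (h.germ g.1 g.2).choose)
  map_one' := by
    have h1 : HasGerm l p 1 1 := ⟨one_pos, Eventually.of_forall fun z => by simp⟩
    have := h.germ_unique (h.germ 1 (one_smul _ _)).choose_spec h1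
    simp [this]
  map_mul' g k := by
    have h1 := h.germ_mul k.2 (h.germ g.1 g.2).choose_spec (h.germ k.1 k.2).choose_spec
    have h2 := h.germ_unique (h.germ (g * k).1 (g * k).2).choose_spec h1
    rw [h2, Real.log_mul (h.germ g.1 g.2).choose_spec.1.ne'
      (h.germ k.1 k.2).choose_spec.1.ne', ofAdd_add]

theorem hasGerm_logSlope (h : IsSide l p) (g : MulAction.stabilizer PLo p) :
    HasGerm l p g.1 (Real.exp (h.logSlope g).toAdd) := by
  have hc := (h.germ g.1 g.2).choose_spec
  have : Real.exp (h.logSlope g).toAdd = (h.germ g.1 g.2).choose := Real.exp_log hc.1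
  rwa [this]

theorem eventually_smul_eq (h : IsSide l p) {g : MulAction.stabilizer PLo p}
    (hg : h.logSlope g = 1) : ∀ᶠ z in l, g.1 • z = z := by
  filter_upwards [(h.hasGerm_logSlope g).2] with z hz
  rw [hg, toAdd_one, Real.exp_zero] at hz
  exact Subtype.ext (by linarith)

theorem eventually_smul_ne (h : IsSide l p) {g : MulAction.stabilizer PLo p}
    (hg : h.logSlope g ≠ 1) : ∀ᶠ z in l, g.1 • z ≠ z := by
  filter_upwards [(h.hasGerm_logSlope g).2, h.ne] with z hz hzp heq
  rw [heq] at hz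
  have hzp' : (z : ℝ) - p ≠ 0 := sub_ne_zero.2 fun h => hzp (Subtype.ext h)
  have h1 : Real.exp (h.logSlope g).toAdd = 1 := mul_right_cancel₀ hzp' (by linarith)
  rw [Real.exp_eq_one_iff] at h1
  exact hg h1

/-- Germs on one side commute, so commutators are trivial near `p`. -/
theorem eventually_smul_eq_of_mem_commutator (h : IsSide l p) {D : Subgroup PLo}
    (hD : ∀ g ∈ D, g • p = p) {g : PLo} (hg : g ∈ ⁅D, D⁆) : ∀ᶠ z in l, g • z = z := by
  have hle : D ≤ MulAction.stabilizer PLo p := hD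
  have h1 := Subgroup.commutator_mono hle hle hg
  rw [← Subgroup.map_subtype_commutator] at h1
  obtain ⟨g, hg', rfl⟩ := h1
  exact h.eventually_smul_eq (Abelianization.commutator_subset_ker h.logSlope hg')

end IsSide

/-- `g` is supported in `[c, d]`, as far as its action on `(a, b)` is concerned. -/
def SuppIn (a b c d : unitInterval) (g : PLo) : Prop :=
  ∀ z ∈ Ioo a b, z ∉ Icc c d → g • z = z

theorem SuppIn.mono {a b c d c' d' : unitInterval} {g : PLo} (h : SuppIn a b c d g)
    (hc : c' ≤ c) (hd : d ≤ d') : SuppIn a b c' d' g :=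
  fun z hz hzn => h z hz fun hz' => hzn ⟨hc.trans hz'.1, hz'.2.trans hd⟩

theorem SuppIn.one {a b c d : unitInterval} : SuppIn a b c d 1 := fun z _ _ => one_smul _ z

/-- Commutators have compact support in every orbital. -/
theorem IsOrbital.exists_suppIn {D : Subgroup PLo} {a b : unitInterval} (h : IsOrbital D a b)
    {g : PLo} (hg : g ∈ ⁅D, D⁆) :
    ∃ c ∈ Ioo a b, ∃ d ∈ Ioo a b, SuppIn a b c d g := by
  have h1 := (isSide_left h.lt).eventually_smul_eq_of_mem_commutator h.right hg
  have h2 := (isSide_right h.lt).eventually_smul_eq_of_mem_commutator h.left hg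
  obtain ⟨d, hd, hd'⟩ := (mem_nhdsLT_iff_exists_mem_Ico_Ioo_subset h.lt).1 h1
  obtain ⟨c, hc, hc'⟩ := (mem_nhdsGT_iff_exists_mem_Ioc_Ioo_subset h.lt).1 h2
  obtain ⟨m, hm⟩ := exists_between h.lt
  refine ⟨min c m, ⟨lt_min hc.1 hm.1, (min_le_right _ _).trans_lt hm.2⟩, max d m,
    ⟨lt_max_of_lt_right hm.1, max_lt hd.2 hm.2⟩, fun z hz hzn => ?_⟩
  rw [mem_Icc, not_and_or, not_le, not_le] at hzn
  rcases hzn with hzn | hzn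
  · exact hc' ⟨hz.1, hzn.trans_le (min_le_left _ _)⟩
  · exact hd' ⟨(le_max_left _ _).trans_lt hzn, hz.2⟩

/-- A common compact support for finitely many elements; it may be enlarged to contain a given
point. -/
theorem exists_common_suppIn {a b x : unitInterval} (hx : x ∈ Ioo a b) {Φ : Set PLo}
    (hΦ : Φ.Finite) (h : ∀ g ∈ Φ, ∃ c ∈ Ioo a b, ∃ d ∈ Ioo a b, SuppIn a b c d g) :
    ∃ c ∈ Ioo a b, ∃ d ∈ Ioo a b, x ∈ Icc c d ∧ ∀ g ∈ Φ, SuppIn a b c d g := by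
  induction Φ, hΦ using Set.Finite.induction_on with
  | empty => exact ⟨x, hx, x, hx, ⟨le_rfl, le_rfl⟩, by simp⟩
  | @insert g Φ _ _ ih =>
    obtain ⟨c, hc, d, hd, hxcd, hcd⟩ := ih fun g hg => h g (mem_insert_of_mem _ hg)
    obtain ⟨c', hc', d', hd', hcd'⟩ := h g (mem_insert _ _)
    refine ⟨min c c', ⟨lt_min hc.1 hc'.1, (min_le_left _ _).trans_lt hc.2⟩, max d d',
      ⟨lt_max_of_lt_left hd.1, max_lt hd.2 hd'.2⟩,
      ⟨(min_le_left _ _).trans hxcd.1, hxcd.2.trans (le_max_left _ _)⟩, ?_⟩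
    rintro k (rfl | hk)
    · exact hcd'.mono (min_le_right _ _) (le_max_right _ _)
    · exact (hcd k hk).mono (min_le_left _ _) (le_max_left _ _)

/-- An element supported in `[c, d]` preserves `[c, d]`, because it preserves the complement. -/
theorem SuppIn.smul_mem {D : Subgroup PLo} {a b c d : unitInterval} (h : IsOrbital D a b)
    (hc : c ∈ Ioo a b) (hd : d ∈ Ioo a b) {g : PLo} (hg : g ∈ D) (hs : SuppIn a b c d g)
    {z : unitInterval} (hz : z ∈ Icc c d) : g • z ∈ Icc c d := by
  by_contra hn
  have h1 := hs _ (h.smul_mem hg ⟨hc.1.trans_le hz.1, hz.2.trans_lt hd.2⟩) hn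
  exact hn ((smul_left_cancel g h1).symm ▸ hz)

theorem SuppIn.conj {D : Subgroup PLo} {a b c d : unitInterval} (h : IsOrbital D a b) {k g : PLo}
    (hk : k ∈ D) (hs : SuppIn a b c d g) : SuppIn a b (k • c) (k • d) (k * g * k⁻¹) := by
  intro z hz hzn
  have h1 := hs (k⁻¹ • z) (h.smul_mem (D.inv_mem hk) hz) fun hmem => hzn
    ⟨by simpa using (PLo.smul_le_smul_iff k).2 hmem.1,
      by simpa using (PLo.smul_le_smul_iff k).2 hmem.2⟩
  rw [mul_smul, mul_smul, h1, smul_inv_smul]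

theorem lift_mem {V : Type*} {D : Subgroup PLo} {η : V → PLo} (hη : ∀ v, η v ∈ D)
    (w : FreeGroup V) : FreeGroup.lift η w ∈ D :=
  FreeGroup.range_lift_le (Set.range_subset_iff.2 hη) ⟨w, rfl⟩

/-- The elements of `D` supported in `[c, d]` form a group. -/
theorem SuppIn.lift {V : Type*} {a b c d : unitInterval} {η : V → PLo}
    (hs : ∀ v, SuppIn a b c d (η v)) (w : FreeGroup V) :
    SuppIn a b c d (FreeGroup.lift η w) := by
  intro z hz hzn
  let St : Subgroup PLo := MulAction.stabilizer PLo z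
  exact lift_mem (D := St) (fun v => hs v z hz hzn) w

/-! ### Elements acting independently on disjoint sites -/

/-- The product of the conjugates of `φ i` by `T i`, over `i ∈ B`. If `φ i` is supported in `C` and
the sites `T i • C` are disjoint, it acts on each site as the corresponding conjugate. -/
noncomputable def siteProd {ι : Type*} (B : Finset ι) (T φ : ι → PLo) : PLo :=
  (B.toList.map fun i => T i * φ i * (T i)⁻¹).prod

theorem siteProd_mem {ι : Type*} {D : Subgroup PLo} {B : Finset ι} {T φ : ι → PLo}
    (hT : ∀ i ∈ B, T i ∈ D) (hφ : ∀ i ∈ B, φ i ∈ D) : siteProd B T φ ∈ D := by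
  refine D.list_prod_mem fun g hg => ?_
  obtain ⟨i, hi, rfl⟩ := List.mem_map.1 hg
  rw [Finset.mem_toList] at hi
  exact D.mul_mem (D.mul_mem (hT i hi) (hφ i hi)) (D.inv_mem (hT i hi))

theorem siteProd_smul {ι : Type*} {D : Subgroup PLo} {a b c d : unitInterval}
    (h : IsOrbital D a b) (hc : c ∈ Ioo a b) (hd : d ∈ Ioo a b) {B : Finset ι} {T φ : ι → PLo}
    (hT : ∀ i ∈ B, T i ∈ D) (hφ : ∀ i ∈ B, φ i ∈ D) (hs : ∀ i ∈ B, SuppIn a b c d (φ i))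
    (hdisj : ∀ i ∈ B, ∀ j ∈ B, i ≠ j → ∀ z ∈ Icc c d, (T i)⁻¹ • T j • z ∉ Icc c d)
    {j : ι} (hj : j ∈ B) {z : unitInterval} (hz : z ∈ Icc c d) :
    siteProd B T φ • T j • z = T j • φ j • z := by
  classical
  have key : ∀ l : List ι, l.Nodup → (∀ i ∈ l, i ∈ B) →
      (l.map fun i => T i * φ i * (T i)⁻¹).prod • T j • z =
        T j • (if j ∈ l then φ j else 1) • z := by
    intro l
    induction l with
    | nil => simp
    | cons i l ih =>
      intro hl hlB
      rw [List.nodup_cons] at hl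
      have hi := hlB i List.mem_cons_self
      rw [List.map_cons, List.prod_cons, mul_smul, ih hl.2 fun i hi => hlB i (by simp [hi])]
      by_cases hij : i = j
      · subst hij
        simp [hl.1, mul_smul]
      · have hz' : (if j ∈ l then φ j else 1) • z ∈ Icc c d := by
          split_ifs
          · exact (hs j hj).smul_mem h hc hd (hφ j hj) hz
          · simpa using hz
        have hfix := hs i hi _ (h.smul_mem (D.inv_mem (hT i hi)) (h.smul_mem (hT j hj)
          ⟨hc.1.trans_le hz'.1, hz'.2.trans_lt hd.2⟩)) (hdisj i hi j hj hij _ hz')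
        rw [mul_smul, mul_smul, hfix, smul_inv_smul]
        simp [Ne.symm hij]
  have := key B.toList B.nodup_toList fun i hi => by simpa using hi
  simpa [siteProd, hj] using this

/-! ### Groups of large derived length satisfy no short law -/

/-- The `n`-th derived subgroup of `D`, as a subgroup of `PL_o(I)`. -/
def iterDerived : ℕ → Subgroup PLo → Subgroup PLo
  | 0, D => D
  | n + 1, D => iterDerived n ⁅D, D⁆

theorem iterDerived_le (n : ℕ) (D : Subgroup PLo) : iterDerived n D ≤ D := by
  induction n generalizing D with
  | zero => exact le_rfl
  | succ n ih => exact (ih _).trans (Subgroup.commutator_le_self D)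

theorem iterDerived_succ' (n : ℕ) (D : Subgroup PLo) :
    iterDerived (n + 1) D = ⁅iterDerived n D, iterDerived n D⁆ := by
  induction n generalizing D with
  | zero => rfl
  | succ n ih => exact ih ⁅D, D⁆

theorem iterDerived_antitone (D : Subgroup PLo) : Antitone fun n => iterDerived n D :=
  antitone_nat_of_succ_le fun n => by
    rw [iterDerived_succ']
    exact Subgroup.commutator_le_self _

theorem iterDerived_eq_map (n : ℕ) (D : Subgroup PLo) :
    iterDerived n D = (derivedSeries D n).map D.subtype := by
  induction n with
  | zero =>
    rw [derivedSeries_zero, ← MonoidHom.range_eq_map, Subgroup.range_subtype]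
    rfl
  | succ n ih => rw [iterDerived_succ', ih, derivedSeries_succ, Subgroup.map_commutator]

/-- If the `l`-th derived subgroup of `D` moves `x`, then `D` satisfies no law of length at most
`l`. Given a word, its first letter `i` is made to act as a displacing element of `D`, and the other
letters as products over the translates of a compact set containing `x`. On that set the word acts
as the shorter word that is read from it, evaluated in `⁅D, D⁆`, whose elements have compact
support. -/
theorem exists_lift_smul_ne {V : Type*} (l : ℕ) (D : Subgroup PLo) {x : unitInterval}
    (hx : ∃ g ∈ iterDerived l D, g • x ≠ x) [DecidableEq V] (w : FreeGroup V) (hw : w ≠ 1)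
    (hl : w.norm ≤ l) :
    ∃ η : V → PLo, (∀ v, η v ∈ D) ∧ (Function.mulSupport η).Finite ∧
      FreeGroup.lift η w • x ≠ x := by
  induction l generalizing V D with
  | zero => exact absurd (FreeGroup.norm_eq_zero.1 (Nat.le_zero.1 hl)) hw
  | succ l ih =>
    obtain ⟨g, hg, hgx⟩ := hx
    obtain ⟨a, b, hab, hxab⟩ := exists_isOrbital (iterDerived_le _ _ hg) hgx
    obtain ⟨L, rfl, hL⟩ : ∃ L, FreeGroup.mk L = w ∧ L.length = w.norm :=
      ⟨w.toWord, FreeGroup.mk_toWord, rfl⟩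
    rw [← hL] at hl
    obtain _ | ⟨⟨i, e⟩, L'⟩ := L
    · exact absurd FreeGroup.one_eq_mk.symm hw
    set L : List (V × Bool) := (i, e) :: L' with hLdef
    set d : V → ℤ := fun s => if s = i then 1 else 0 with hd
    set r : V → ℤ → FreeGroup (V × ℤ) := fun s n => if s = i then 1 else FreeGroup.of (s, n)
      with hr
    have hd1 : ∀ s, ‖d s‖ ≤ 1 := by
      intro s
      by_cases hs : s = i <;> simp [hd, hs]
    by_cases hn : (readWord d r L 0).1 = 0
    · -- The path of positions closes up, and the word that is read is evaluated in `⁅D, D⁆`.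
      have hR : (readWord d r L 0).2 ≠ 1 := fun hR =>
        hw (mk_eq_one_of_readWord_eq (AddMonoidHom.id ℤ) (i := i) hd1 (by simp [hd])
          (fun s hs => by simp [hd, hs]) (fun α => by simp [hr]) (fun s hs α => by simp [hr, hs])
          0 L (by simpa using hn) hR)
      have hnorm : (readWord d r L 0).2.norm ≤ l := by
        refine (norm_readWord_snd_le (i := i) d (r := r) (fun α => by simp [hr])
          (fun s n => by by_cases hs : s = i <;> simp [hr, hs]) 0 L).trans ?_
        rw [hLdef, List.countP_cons_of_neg (by simp)]
        rw [hLdef, List.length_cons] at hl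
        exact List.countP_le_length.trans (by omega)
      obtain ⟨η, hη, hfin, hηx⟩ := ih ⁅D, D⁆ ⟨g, hg, hgx⟩ _ hR hnorm
      have hηD : ∀ v, η v ∈ D := fun v => Subgroup.commutator_le_self D (hη v)
      obtain ⟨c, hc, d', hd', hxcd, hsupp⟩ := exists_common_suppIn hxab
        (hfin.image η) (by rintro _ ⟨v, _, rfl⟩; exact hab.exists_suppIn (hη v))
      have hs : ∀ v, SuppIn a b c d' (η v) := by
        intro v
        by_cases hv : η v = 1
        · rw [hv]
          exact SuppIn.one
        · exact hsupp _ ⟨v, hv, rfl⟩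
      obtain ⟨k, hk, hkc⟩ := hab.exists_lt_smul hc hd'
      set B : Finset ℤ := Finset.Icc (-(L.length : ℤ)) L.length with hB
      have hT : ∀ n ∈ B, k ^ n ∈ D := fun n _ => D.zpow_mem hk n
      set θ : V → PLo := fun s =>
        if s = i then k else siteProd B (fun n => k ^ n) fun n => η (s, n) with hθ
      refine ⟨θ, fun s => ?_, ?_, ?_⟩
      · by_cases hsi : s = i
        · simpa [hθ, hsi] using hk
        · simpa [hθ, hsi] using siteProd_mem hT fun n _ => hηD (s, n)
      · refine ((hfin.image Prod.fst).insert i).subset fun s hs1 => ?_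
        by_contra hs2
        rw [mem_insert_iff, not_or] at hs2
        have h1 : ∀ n, η (s, n) = 1 := by
          intro n
          by_contra h1
          exact hs2.2 ⟨(s, n), h1, rfl⟩
        exact hs1 (by simp [hθ, hs2.1, siteProd, h1])
      · have h1 := lift_smul_eq_readWord (g := θ) (T := fun n : ℤ => k ^ n) (r := r) (η := η)
          (C := Icc c d') (N := L.length) hd1
          (fun w z hz => (SuppIn.lift hs w).smul_mem hab hc hd' (lift_mem hηD w) hz)
          (fun s n hn z hz => by
            by_cases hsi : s = i
            · simp only [hθ, hd, hr, hsi, if_true, map_one, one_smul]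
              rw [add_comm, zpow_one_add, mul_smul]
            · have hnB : n ∈ B := by
                rw [Int.norm_eq_abs] at hn
                rw [hB, Finset.mem_Icc, ← abs_le]
                exact_mod_cast hn
              have := siteProd_smul hab hc hd' (T := fun n => k ^ n) (φ := fun n => η (s, n)) hT
                (fun n _ => hηD (s, n)) (fun n _ => hs (s, n))
                (fun m _ n _ hmn z hz => by
                  rw [← mul_smul, ← zpow_neg, ← zpow_add]
                  exact IsOrbital.zpow_smul_notMem hkc (by omega) hz) hnB hz
              simpa [hθ, hd, hr, hsi] using this)
          0 L (by simp) hxcd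
        simp only [zpow_zero, one_smul, hn] at h1
        rw [h1]
        exact hηx
    · -- The word has a nonzero exponent sum in `i`, so it is seen in a cyclic group.
      have hgD := iterDerived_le _ _ hg
      refine ⟨fun s => if s = i then g else 1, fun s => ?_, ?_, ?_⟩
      · dsimp only
        split_ifs
        exacts [hgD, D.one_mem]
      · refine (Set.finite_singleton i).subset fun s hs => ?_
        by_contra hsi
        exact hs (if_neg hsi)
      · have h1 := lift_smul_eq_readWord (g := fun s => if s = i then g else 1)
          (T := fun n : ℤ => g ^ n) (r := r) (η := fun _ => 1) (C := univ) (N := L.length) hd1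
          (fun _ _ _ => mem_univ _)
          (fun s n _ z _ => by
            have h1 : FreeGroup.lift (fun _ : V × ℤ => (1 : PLo)) = 1 := by ext; simp
            rw [h1, MonoidHom.one_apply, one_smul]
            by_cases hsi : s = i
            · simp only [hd, hsi, if_true]
              rw [add_comm, zpow_one_add, mul_smul]
            · simp [hd, hsi]) 0 L (by simp) (mem_univ x)
        have h2 : FreeGroup.lift (fun _ : V × ℤ => (1 : PLo)) = 1 := by ext; simp
        rw [h2, MonoidHom.one_apply, one_smul, zpow_zero, one_smul] at h1
        rw [h1]
        exact PLo.zpow_smul_ne g hgx hn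

/-- If each `θ v` acts on `k • C` as the conjugate of `η v`, then so do all words. -/
theorem lift_smul_smul {V G X : Type*} [Group G] [MulAction G X] {θ η : V → G} {C : Set X} (k : G)
    (hC : ∀ w, ∀ z ∈ C, FreeGroup.lift η w • z ∈ C)
    (h : ∀ v, ∀ z ∈ C, θ v • k • z = k • η v • z) (w : FreeGroup V) {z : X} (hz : z ∈ C) :
    FreeGroup.lift θ w • k • z = k • FreeGroup.lift η w • z := by
  induction w using FreeGroup.induction_on generalizing z with
  | C1 => simp
  | of v => simpa using h v z hz
  | inv_of v _ =>
    have h1 := h v _ (hC (FreeGroup.of v)⁻¹ z hz)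
    rw [map_inv, FreeGroup.lift_apply_of, smul_inv_smul] at h1
    rw [map_inv, map_inv, FreeGroup.lift_apply_of, FreeGroup.lift_apply_of, ← h1, inv_smul_smul]
  | mul v w h1 h2 => rw [map_mul, map_mul, mul_smul, mul_smul, h2 hz, h1 (hC w z hz)]

/-- If all derived subgroups of `D` act nontrivially on an orbital, then finitely many nontrivial
words can be made nontrivial there by a single assignment of elements of `D` with a
common compact support: the assignments for the different words are moved to disjoint sites. -/
theorem exists_forall_lift_smul_ne {V : Type*} {D : Subgroup PLo} {a b : unitInterval}
    (hab : IsOrbital D a b)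
    (hder : ∀ n, ∃ x ∈ Ioo a b, ∃ g ∈ iterDerived n D, g • x ≠ x) (Q : Finset (FreeGroup V))
    (hQ : (1 : FreeGroup V) ∉ Q) :
    ∃ c ∈ Ioo a b, ∃ d ∈ Ioo a b, c ≤ d ∧ ∃ η : V → PLo, (∀ v, η v ∈ D) ∧
      (∀ v, SuppIn a b c d (η v)) ∧ ∀ w ∈ Q, ∃ x ∈ Icc c d, FreeGroup.lift η w • x ≠ x := by
  classical
  induction Q using Finset.induction_on with
  | empty =>
    obtain ⟨m, hm⟩ := exists_between hab.lt
    exact ⟨m, hm, m, hm, le_rfl, fun _ => 1, fun _ => D.one_mem, fun _ => SuppIn.one, by simp⟩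
  | @insert w Q _ ih =>
    rw [Finset.mem_insert, not_or] at hQ
    obtain ⟨c, hc, d, hd, hcd, η, hηD, hηs, hηx⟩ := ih hQ.2
    obtain ⟨x, hx, hxg⟩ := hder (w.norm + 1)
    obtain ⟨η', hη', hfin, hη'x⟩ := exists_lift_smul_ne w.norm ⁅D, D⁆ hxg w (Ne.symm hQ.1) le_rfl
    have hη'D : ∀ v, η' v ∈ D := fun v => Subgroup.commutator_le_self D (hη' v)
    obtain ⟨c', hc', d', hd', hxcd, hsupp⟩ := exists_common_suppIn hx
      (hfin.image η') (by rintro _ ⟨v, _, rfl⟩; exact hab.exists_suppIn (hη' v))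
    have hs' : ∀ v, SuppIn a b c' d' (η' v) := by
      intro v
      by_cases hv : η' v = 1
      · rw [hv]
        exact SuppIn.one
      · exact hsupp _ ⟨v, hv, rfl⟩
    -- `k` moves the support of `η'` above the support of `η`.
    obtain ⟨k, hk, hkd⟩ := hab.exists_lt_smul hc' hd
    have hkc' := hab.smul_mem hk hc'
    have hkd' := hab.smul_mem hk hd'
    have hcd' : c' ≤ d' := hxcd.1.trans hxcd.2
    have hconj : ∀ v, SuppIn a b (k • c') (k • d') (k * η' v * k⁻¹) := fun v => (hs' v).conj hab hk
    have hconjD : ∀ v, k * η' v * k⁻¹ ∈ D := fun v =>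
      D.mul_mem (D.mul_mem hk (hη'D v)) (D.inv_mem hk)
    have hlow : ∀ w : FreeGroup V, ∀ z ∈ Icc c d,
        FreeGroup.lift (fun v => η v * (k * η' v * k⁻¹)) w • z = FreeGroup.lift η w • z := by
      intro w z hz
      have h1 := lift_smul_smul (θ := fun v => η v * (k * η' v * k⁻¹)) (η := η) (C := Icc c d) 1
        (fun w z hz => (SuppIn.lift hηs w).smul_mem hab hc hd (lift_mem hηD w) hz)
        (fun v z hz => by
          rw [one_smul, one_smul, mul_smul, hconj v z ⟨hc.1.trans_le hz.1, hz.2.trans_lt hd.2⟩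
            fun hmem => absurd (hkd.trans_le hmem.1) (not_lt.2 hz.2)]) w hz
      simpa using h1
    have hhigh : ∀ w : FreeGroup V, ∀ z ∈ Icc c' d',
        FreeGroup.lift (fun v => η v * (k * η' v * k⁻¹)) w • k • z =
          k • FreeGroup.lift η' w • z := by
      intro w z hz
      refine lift_smul_smul k
        (fun w z hz => (SuppIn.lift hs' w).smul_mem hab hc' hd' (lift_mem hη'D w) hz)
        (fun v z hz => ?_) w hz
      have hz' := (hs' v).smul_mem hab hc' hd' (hη'D v) hz
      rw [mul_smul, mul_smul, mul_smul, inv_smul_smul]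
      exact hηs v _ (hab.smul_mem hk ⟨hc'.1.trans_le hz'.1, hz'.2.trans_lt hd'.2⟩)
        fun hmem => absurd (hkd.trans_le ((PLo.smul_le_smul_iff k).2 hz'.1)) (not_lt.2 hmem.2)
    refine ⟨min c (k • c'), ⟨lt_min hc.1 hkc'.1, (min_le_left _ _).trans_lt hc.2⟩,
      max d (k • d'), ⟨lt_max_of_lt_left hd.1, max_lt hd.2 hkd'.2⟩,
      (min_le_left _ _).trans (hcd.trans (le_max_left _ _)), fun v => η v * (k * η' v * k⁻¹), 
      fun v => D.mul_mem (hηD v) (hconjD v), fun v z hz hzn => ?_, fun w' hw' => ?_⟩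
    · rw [mul_smul, (hconj v).mono (min_le_right _ _) (le_max_right _ _) z hz hzn,
        (hηs v).mono (min_le_left _ _) (le_max_left _ _) z hz hzn]
    · rcases Finset.mem_insert.1 hw' with rfl | hw'
      · refine ⟨k • x, ⟨(min_le_right _ _).trans ((PLo.smul_le_smul_iff k).2 hxcd.1),
          ((PLo.smul_le_smul_iff k).2 hxcd.2).trans (le_max_right _ _)⟩, ?_⟩
        rw [hhigh _ x hxcd]
        exact fun heq => hη'x (smul_left_cancel k heq)
      · obtain ⟨y, hy, hyw⟩ := hηx w' hw'
        refine ⟨y, ⟨(min_le_left _ _).trans hy.1, hy.2.trans (le_max_left _ _)⟩, ?_⟩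
        rw [hlow w' y hy]
        exact hyw

/-! ### Finitely generated groups: local finiteness of orbitals -/

theorem IsSide.eventually_forall_smul_eq {l : Filter unitInterval} {p : unitInterval}
    (h : IsSide l p) {Γ : Subgroup PLo} (hΓ : Γ.FG) (hp : Γ ≤ MulAction.stabilizer PLo p)
    (hslope : ∀ g (hg : g ∈ Γ), h.logSlope ⟨g, hp hg⟩ = 1) :
    ∀ᶠ z in l, ∀ g ∈ Γ, g • z = z := by
  obtain ⟨S, rfl⟩ := hΓ
  have h1 : ∀ᶠ z in l, ∀ g ∈ S, g • z = z := by
    rw [eventually_all_finset]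
    intro g hg
    exact h.eventually_smul_eq (hslope g (Subgroup.subset_closure hg))
  filter_upwards [h1] with z hz
  exact (Subgroup.closure_le (MulAction.stabilizer PLo z)).2 hz

/-- Near a fixed point, a finitely generated group either acts trivially or has no other fixed
point. -/
theorem IsSide.eventually_fixed_or_exists_isOrbital {l : Filter unitInterval} {p : unitInterval}
    (h : IsSide l p) {Γ : Subgroup PLo} (hΓ : Γ.FG) (hp : Γ ≤ MulAction.stabilizer PLo p) :
    (∀ᶠ z in l, ∀ g ∈ Γ, g • z = z) ∨ ∃ a b, IsOrbital Γ a b ∧ Ioo a b ∈ l := by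
  by_cases hslope : ∀ g (hg : g ∈ Γ), h.logSlope ⟨g, hp hg⟩ = 1
  · exact Or.inl (h.eventually_forall_smul_eq hΓ hp hslope)
  · push Not at hslope
    obtain ⟨g, hg, hne⟩ := hslope
    obtain ⟨t, ht, hts, htc⟩ := h.exists_ordConnected _ (h.eventually_smul_ne hne)
    have := h.neBot
    obtain ⟨y, hy⟩ := Filter.nonempty_of_mem ht
    obtain ⟨a, b, hab, hyab⟩ := exists_isOrbital hg (hts hy)
    exact Or.inr ⟨a, b, hab, mem_of_superset ht
      (hab.subset_of_ordConnected htc (fun z hz => ⟨g, hg, hts hz⟩) hy hyab)⟩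

/-- By compactness of `[0,1]`, finitely many orbitals and fixed intervals suffice to cover it, so
solvability can be tested in the orbitals separately. -/
theorem exists_isOrbital_of_not_isSolvable {Γ : Subgroup PLo} (hΓ : Γ.FG)
    (hsol : ¬ Group.IsSolvable Γ) :
    ∃ a b, IsOrbital Γ a b ∧ ∀ n, ∃ x ∈ Ioo a b, ∃ g ∈ iterDerived n Γ, g • x ≠ x := by
  by_contra! hall
  have hmono : ∀ {m n : ℕ}, m ≤ n → ∀ {z : unitInterval}, (∀ g ∈ iterDerived m Γ, g • z = z) →
      ∀ g ∈ iterDerived n Γ, g • z = z := fun hmn _ hz g hg => hz g (iterDerived_antitone Γ hmn hg)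
  have hside : ∀ {l : Filter unitInterval} {p : unitInterval}, IsSide l p →
      Γ ≤ MulAction.stabilizer PLo p → ∃ n, ∀ᶠ z in l, ∀ g ∈ iterDerived n Γ, g • z = z := by
    intro l p h hp
    rcases h.eventually_fixed_or_exists_isOrbital hΓ hp with h1 | ⟨a, b, hab, hmem⟩
    · exact ⟨0, h1⟩
    · obtain ⟨n, hn⟩ := hall a b hab
      exact ⟨n, mem_of_superset hmem hn⟩
  have hlocal : ∀ x : unitInterval, ∃ n, ∀ᶠ z in 𝓝 x, ∀ g ∈ iterDerived n Γ, g • z = z := by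
    intro x
    by_cases hx : ∃ g ∈ Γ, g • x ≠ x
    · obtain ⟨g, hg, hgx⟩ := hx
      obtain ⟨a, b, hab, hxab⟩ := exists_isOrbital hg hgx
      obtain ⟨n, hn⟩ := hall a b hab
      exact ⟨n, mem_of_superset (Ioo_mem_nhds hxab.1 hxab.2) hn⟩
    · push Not at hx
      have hleft : ∃ n, ∀ᶠ z in 𝓝[<] x, ∀ g ∈ iterDerived n Γ, g • z = z := by
        rcases eq_or_lt_of_le (unitInterval.nonneg' (t := x)) with h0 | h0
        · refine ⟨0, ?_⟩
          have : Iio x = ∅ := by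
            ext z
            simp [← h0]
          simp [this]
        · exact hside (isSide_left h0) hx
      have hright : ∃ n, ∀ᶠ z in 𝓝[>] x, ∀ g ∈ iterDerived n Γ, g • z = z := by
        rcases eq_or_lt_of_le (unitInterval.le_one' (t := x)) with h1 | h1
        · refine ⟨0, ?_⟩
          have : Ioi x = ∅ := by
            ext z
            simpa [h1] using unitInterval.le_one' (t := z)
          simp [this]
        · exact hside (isSide_right h1) hx
      obtain ⟨m, hm⟩ := hleft
      obtain ⟨n, hn⟩ := hright
      refine ⟨max m n, ?_⟩
      rw [← nhdsNE_sup_pure, ← nhdsLT_sup_nhdsGT, eventually_sup, eventually_sup]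
      refine ⟨⟨hm.mono fun z hz => hmono (le_max_left _ _) hz,
        hn.mono fun z hz => hmono (le_max_right _ _) hz⟩, ?_⟩
      exact hmono (Nat.zero_le _) (m := 0) hx
  obtain ⟨n, hn⟩ : ∃ n, ∀ z ∈ (univ : Set unitInterval), ∀ g ∈ iterDerived n Γ, g • z = z := by
    refine isCompact_univ.induction_on (p := fun s => ∃ n, ∀ z ∈ s, ∀ g ∈ iterDerived n Γ,
      g • z = z) ⟨0, by simp⟩ (fun s t hst ⟨n, hn⟩ => ⟨n, fun z hz => hn z (hst hz)⟩)
      (fun s t ⟨m, hm⟩ ⟨n, hn⟩ => ⟨max m n, ?_⟩) fun x _ => ?_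
    · rintro z (hz | hz)
      · exact hmono (le_max_left _ _) (hm z hz)
      · exact hmono (le_max_right _ _) (hn z hz)
    · obtain ⟨n, hn⟩ := hlocal x
      exact ⟨_, mem_nhdsWithin_of_mem_nhds hn, n, fun z hz => hz⟩
  refine hsol ⟨n, ?_⟩
  have h1 : iterDerived n Γ = ⊥ := by
    rw [eq_bot_iff]
    intro g hg
    rw [Subgroup.mem_bot]
    exact Subtype.ext (Homeomorph.ext fun z => hn z (mem_univ z) g hg)
  rw [iterDerived_eq_map] at h1
  exact (Subgroup.map_eq_bot_iff_of_injective _ Γ.subtype_injective).1 h1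

/-- In an orbital `(a, b)` of a finitely generated group, some element contracts towards `b`. -/
theorem IsOrbital.exists_logSlope_neg {Γ : Subgroup PLo} (hΓ : Γ.FG) {a b : unitInterval}
    (h : IsOrbital Γ a b) :
    ∃ f, ∃ hf : f ∈ Γ, ((isSide_left h.lt).logSlope ⟨f, h.right f hf⟩).toAdd < 0 := by
  by_contra! hall
  have hs := isSide_left h.lt
  have hone : ∀ g (hg : g ∈ Γ), (isSide_left h.lt).logSlope ⟨g, h.right g hg⟩ = 1 := by
    intro g hg
    have h1 := hall g hg
    have h2 := hall g⁻¹ (Γ.inv_mem hg)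
    have h3 : (⟨g⁻¹, h.right _ (Γ.inv_mem hg)⟩ : MulAction.stabilizer PLo b) =
      ⟨g, h.right g hg⟩⁻¹ := rfl
    rw [h3, map_inv, toAdd_inv] at h2
    exact Multiplicative.toAdd.injective (le_antisymm (by simpa using h2) h1)
  have := hs.neBot
  obtain ⟨z, hz, hab⟩ :=
    ((hs.eventually_forall_smul_eq hΓ h.right hone).and (Ioo_mem_nhdsLT h.lt)).exists
  obtain ⟨g, hg, hgz⟩ := h.moved z hab
  exact hgz (hz g hg)

/-! ### Choosing generators with generic slopes -/

/-- Adding suitable multiples of `ℓ` to finitely many reals makes all their short integral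
combinations large, apart from the trivial one. -/
theorem exists_forall_lt_abs_sum {ι : Type*} [Fintype ι] (s : ι → ℝ) {ℓ Λ : ℝ} (hΛ : 0 ≤ Λ)
    (hℓ : Λ < |ℓ|) (N : ℕ) :
    ∃ p : ι → ℤ, ∀ (m : ℤ) (γ : ι → ℤ), |m| ≤ N → (∀ i, |γ i| ≤ N) → (m ≠ 0 ∨ γ ≠ 0) →
      Λ < |m * ℓ + ∑ i, γ i * (s i + p i * ℓ)| := by
  classical
  have hℓ0 : 0 < |ℓ| := hΛ.trans_lt hℓ
  have key : ∀ F : Finset ι, ∃ p : ι → ℤ, ∀ (m : ℤ) (γ : ι → ℤ), |m| ≤ N → (∀ i, |γ i| ≤ N) →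
      (m ≠ 0 ∨ ∃ i ∈ F, γ i ≠ 0) → Λ < |m * ℓ + ∑ i ∈ F, γ i * (s i + p i * ℓ)| := by
    intro F
    induction F using Finset.induction_on with
    | empty =>
      refine ⟨0, fun m γ _ _ h => ?_⟩
      have hm : m ≠ 0 := by simpa using h
      have h1 : (1 : ℝ) ≤ |(m : ℝ)| := by exact_mod_cast Int.one_le_abs hm
      rw [Finset.sum_empty, add_zero, abs_mul]
      nlinarith
    | @insert j F hj ih =>
      obtain ⟨p, hp⟩ := ih
      set M : ℝ := Λ + N * |ℓ| + ∑ i ∈ F, N * |s i + p i * ℓ| with hM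
      obtain ⟨n, hn⟩ := exists_nat_gt ((M + |s j|) / |ℓ|)
      rw [div_lt_iff₀ hℓ0] at hn
      have hvj : M < |s j + (n : ℤ) * ℓ| := by
        have h1 := abs_sub_abs_le_abs_sub ((n : ℤ) * ℓ) (-s j)
        rw [abs_neg, abs_mul, sub_neg_eq_add, add_comm _ (s j)] at h1
        have h2 : |((n : ℤ) : ℝ)| = n := by simp
        rw [h2] at h1
        linarith
      refine ⟨Function.update p j n, fun m γ hm hγ h => ?_⟩
      have hsum : ∑ i ∈ F, γ i * (s i + Function.update p j n i * ℓ) =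
          ∑ i ∈ F, γ i * (s i + p i * ℓ) :=
        Finset.sum_congr rfl fun i hi => by
          rw [Function.update_of_ne (ne_of_mem_of_not_mem hi hj)]
      rw [Finset.sum_insert hj, hsum, Function.update_self]
      by_cases hγj : γ j = 0
      · rw [hγj, Int.cast_zero, zero_mul, zero_add]
        refine hp m γ hm hγ (h.imp_right ?_)
        rintro ⟨i, hi, hi'⟩
        rcases Finset.mem_insert.1 hi with rfl | hi
        exacts [absurd hγj hi', ⟨i, hi, hi'⟩]
      · have h1 : (1 : ℝ) ≤ |(γ j : ℝ)| := by exact_mod_cast Int.one_le_abs hγj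
        have h2 : |s j + (n : ℤ) * ℓ| ≤ |γ j * (s j + (n : ℤ) * ℓ)| := by
          rw [abs_mul]
          exact le_mul_of_one_le_left (abs_nonneg _) h1
        have h3 : |m * ℓ| ≤ N * |ℓ| := by
          rw [abs_mul]
          exact mul_le_mul_of_nonneg_right (by exact_mod_cast hm) (abs_nonneg _)
        have h4 : |∑ i ∈ F, γ i * (s i + p i * ℓ)| ≤ ∑ i ∈ F, N * |s i + p i * ℓ| := by
          refine (Finset.abs_sum_le_sum_abs _ _).trans (Finset.sum_le_sum fun i _ => ?_)
          rw [abs_mul]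
          exact mul_le_mul_of_nonneg_right (by exact_mod_cast hγ i) (abs_nonneg _)
        have h5 := abs_sub_abs_le_abs_sub (γ j * (s j + (n : ℤ) * ℓ))
          (-(m * ℓ + ∑ i ∈ F, γ i * (s i + p i * ℓ)))
        rw [abs_neg, sub_neg_eq_add] at h5
        have h6 := abs_add_le (m * ℓ) (∑ i ∈ F, γ i * (s i + p i * ℓ))
        have h7 : m * ℓ + (γ j * (s j + (n : ℤ) * ℓ) + ∑ i ∈ F, γ i * (s i + p i * ℓ)) =
          γ j * (s j + (n : ℤ) * ℓ) + (m * ℓ + ∑ i ∈ F, γ i * (s i + p i * ℓ)) := by ring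
        rw [h7]
        linarith
  obtain ⟨p, hp⟩ := key Finset.univ
  refine ⟨p, fun m γ hm hγ h => hp m γ hm hγ (h.imp_right fun h => ?_)⟩
  obtain ⟨i, hi⟩ := Function.ne_iff.1 h
  exact ⟨i, Finset.mem_univ i, hi⟩

theorem finite_norm_le (J : Type*) [Fintype J] (R : ℝ) :
    {α : ℤ × (J → ℤ) | ‖α‖ ≤ R}.Finite := by
  have h := isCompact_closedBall (0 : ℤ × (J → ℤ)) R
  refine h.finite_of_discrete.subset fun α hα => ?_
  simpa using hα

theorem abs_le_of_norm_le {J : Type*} [Fintype J] {α : ℤ × (J → ℤ)} {R : ℕ} (h : ‖α‖ ≤ R) :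
    |α.1| ≤ R ∧ ∀ j, |α.2 j| ≤ R := by
  constructor
  · have := (norm_fst_le α).trans h
    rw [Int.norm_eq_abs] at this
    exact_mod_cast this
  · intro j
    have := (norm_le_pi_norm α.2 j).trans ((norm_snd_le α).trans h)
    rw [Int.norm_eq_abs] at this
    exact_mod_cast this

section Sites

variable {Γ : Subgroup PLo} {a b : unitInterval}

/-- The logarithm of the slope at the right end point of an orbital. -/
noncomputable def IsOrbital.logSlope (h : IsOrbital Γ a b) : Γ →* Multiplicative ℝ :=
  (isSide_left h.lt).logSlope.comp (Subgroup.inclusion (K := MulAction.stabilizer PLo b) h.right)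

theorem IsOrbital.eventually_eq (h : IsOrbital Γ a b) (g : Γ) :
    ∀ᶠ z in 𝓝[<] b, ((g • z : unitInterval) : ℝ) =
      b + Real.exp (h.logSlope g).toAdd * (z - b) :=
  ((isSide_left h.lt).hasGerm_logSlope ⟨g, h.right g g.2⟩).2

theorem IsOrbital.eventually_smul_eq_smul (h : IsOrbital Γ a b) {g k : Γ}
    (hgk : h.logSlope g = h.logSlope k) : ∀ᶠ z in 𝓝[<] b, g • z = k • z := by
  filter_upwards [h.eventually_eq g, h.eventually_eq k] with z h1 h2
  rw [hgk] at h1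
  exact Subtype.ext (h1.trans h2.symm)

/-- An element contracting towards `b` moves compact sets near `b`, keeping the ratio of the
distances of their end points from `b`. -/
theorem IsOrbital.exists_contracting (h : IsOrbital Γ a b) {f : Γ}
    (hf : (h.logSlope f).toAdd < 0) {c d : unitInterval} (hc : c ∈ Ioo a b) (hd : d ∈ Ioo a b)
    (hcd : c ≤ d) :
    ∃ Λ : ℝ, ∀ s ∈ 𝓝[<] b, ∃ k : Γ, (k • c ∈ Ioo a b) ∧ (k • d ∈ Ioo a b) ∧
      Icc (k • c) (k • d) ⊆ s ∧
      Real.log (b - (k • c : unitInterval)) - Real.log (b - (k • d : unitInterval)) = Λ := by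
  set r : ℝ := Real.exp (h.logSlope f).toAdd with hr
  have hr0 : 0 < r := Real.exp_pos _
  have hr1 : r < 1 := Real.exp_lt_one_iff.2 hf
  obtain ⟨e, he, heq⟩ := (mem_nhdsLT_iff_exists_mem_Ico_Ioo_subset h.lt).1 (h.eventually_eq f)
  obtain ⟨e', he', heb'⟩ := exists_between he.2
  obtain ⟨g, hg, hge⟩ := h.exists_lt_smul hc (d := e') ⟨he.1.trans_lt he', heb'⟩
  have hec : g • c ∈ Ioo e b := ⟨he'.trans hge, (h.smul_mem hg hc).2⟩
  have hed : g • d ∈ Ioo e b :=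
    ⟨hec.1.trans_le ((PLo.smul_le_smul_iff g).2 hcd), (h.smul_mem hg hd).2⟩
  have hpow : ∀ y ∈ Ioo e b, ∀ n : ℕ, f ^ n • y ∈ Ioo e b ∧
      ((f ^ n • y : unitInterval) : ℝ) = b + r ^ n * (y - b) := by
    intro y hy n
    have hyb : (y : ℝ) < b := hy.2
    have hye : (e : ℝ) < y := hy.1
    induction n with
    | zero => simpa using hy
    | succ n ih =>
      have h1 := heq ih.1
      have h2 : ((f ^ (n + 1) • y : unitInterval) : ℝ) = b + r ^ (n + 1) * (y - b) := by
        rw [pow_succ', mul_smul]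
        refine h1.trans ?_
        rw [ih.2]
        ring
      have h3 : r ^ (n + 1) ≤ 1 := pow_le_one₀ hr0.le hr1.le
      have h4 : 0 < r ^ (n + 1) := pow_pos hr0 _
      refine ⟨⟨?_, ?_⟩, h2⟩
      · change (e : ℝ) < (f ^ (n + 1) • y : unitInterval)
        rw [h2]
        nlinarith
      · change ((f ^ (n + 1) • y : unitInterval) : ℝ) < b
        rw [h2]
        nlinarith
  have hcb : ((g • c : unitInterval) : ℝ) < b := hec.2
  have hdb : ((g • d : unitInterval) : ℝ) < b := hed.2
  refine ⟨Real.log (b - (g • c : unitInterval)) - Real.log (b - (g • d : unitInterval)),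
    fun s hs => ?_⟩
  obtain ⟨e₂, he₂, hs₂⟩ := (mem_nhdsLT_iff_exists_mem_Ico_Ioo_subset h.lt).1 hs
  have he₂b : (e₂ : ℝ) < b := he₂.2
  obtain ⟨n, hn⟩ := exists_pow_lt_of_lt_one
    (div_pos (sub_pos.2 he₂b) (sub_pos.2 hcb)) hr1
  rw [lt_div_iff₀ (sub_pos.2 hcb)] at hn
  have hkc := hpow _ hec n
  have hkd := hpow _ hed n
  have hk : ∀ y : unitInterval, (f ^ n * ⟨g, hg⟩ : Γ) • y = f ^ n • g • y := fun y => mul_smul _ _ _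
  refine ⟨f ^ n * ⟨g, hg⟩, ?_, ?_, ?_, ?_⟩
  · rw [hk]
    exact ⟨he.1.trans_lt hkc.1.1, hkc.1.2⟩
  · rw [hk]
    exact ⟨he.1.trans_lt hkd.1.1, hkd.1.2⟩
  · rw [hk, hk]
    refine fun z hz => hs₂ ⟨?_, hz.2.trans_lt hkd.1.2⟩
    refine lt_of_lt_of_le ?_ hz.1
    change (e₂ : ℝ) < (f ^ n • g • c : unitInterval)
    rw [hkc.2]
    linarith
  · rw [hk, hk, hkc.2, hkd.2]
    have h1 : ∀ y : ℝ, (b : ℝ) - (b + r ^ n * (y - b)) = r ^ n * (b - y) := fun y => by ring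
    have h2 : r ^ n ≠ 0 := (pow_pos hr0 n).ne'
    rw [h1, h1, Real.log_mul h2 (sub_pos.2 hcb).ne', Real.log_mul h2 (sub_pos.2 hdb).ne']
    ring

/-- The geometric part of the construction of generating sets of large girth: there are generators
`t` and `x j = s j * t ^ p j` such that products `T α` of their powers, for `α` in a large box, move
a translate of `[c, d]` to disjoint sites, and there the products behave as if `t` and the `x j`
commuted. -/
theorem IsOrbital.exists_sites (h : IsOrbital Γ a b) (hΓ : Γ.FG) {c d : unitInterval}
    (hc : c ∈ Ioo a b) (hd : d ∈ Ioo a b) (hcd : c ≤ d) {J : Type*} [Fintype J] [DecidableEq J] (s : J → Γ)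
    (R : ℕ) :
    ∃ (t : Γ) (p : J → ℤ) (T : ℤ × (J → ℤ) → Γ) (k : Γ),
      T 0 = 1 ∧ (∀ m α, T (α + (m, 0)) = t ^ m * T α) ∧
      (∀ α, ‖α‖ ≤ R → ∀ j, ∀ z ∈ Icc (k • c) (k • d),
        (s j * t ^ p j) • T α • z = T (α + (0, Pi.single j 1)) • z) ∧
      ∀ α β, ‖α‖ ≤ R → ‖β‖ ≤ R → α ≠ β → ∀ z ∈ Icc (k • c) (k • d),
        (T α)⁻¹ • T β • z ∉ Icc (k • c) (k • d) := by
  obtain ⟨f, hfΓ, hf⟩ := h.exists_logSlope_neg hΓ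
  obtain ⟨Λ, hΛ⟩ := h.exists_contracting (f := ⟨f, hfΓ⟩) hf hc hd hcd
  have hf' : (h.logSlope ⟨f, hfΓ⟩).toAdd < 0 := hf
  obtain ⟨K, hK⟩ := exists_nat_gt (|Λ| / |(h.logSlope ⟨f, hfΓ⟩).toAdd|)
  rw [div_lt_iff₀ (abs_pos.2 hf'.ne)] at hK
  set t : Γ := ⟨f, hfΓ⟩ ^ K with ht
  set ℓ : ℝ := (h.logSlope t).toAdd with hℓ
  have hℓΛ : |Λ| < |ℓ| := by
    rw [hℓ, ht, map_pow, toAdd_pow, nsmul_eq_mul, abs_mul, Nat.abs_cast]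
    exact hK
  obtain ⟨p, hp⟩ := exists_forall_lt_abs_sum (fun j => (h.logSlope (s j)).toAdd)
    (abs_nonneg Λ) hℓΛ (2 * R)
  set T : ℤ × (J → ℤ) → Γ := fun α =>
    t ^ α.1 * ((Finset.univ : Finset J).toList.map fun j => (s j * t ^ p j) ^ α.2 j).prod with hT
  have hslope : ∀ α, (h.logSlope (T α)).toAdd =
      α.1 * ℓ + ∑ j, α.2 j * ((h.logSlope (s j)).toAdd + p j * ℓ) := by
    intro α
    rw [hT]
    simp only [map_mul, map_zpow, map_list_prod, List.map_map, Function.comp_def]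
    rw [Finset.prod_map_toList, toAdd_mul, toAdd_zpow, toAdd_prod]
    simp [hℓ, mul_add]
  have hev : ∀ᶠ z in 𝓝[<] b, z ∈ Ioo a b ∧ ∀ α ∈ {α : ℤ × (J → ℤ) | ‖α‖ ≤ R},
      ((T α • z : unitInterval) : ℝ) = b + Real.exp (h.logSlope (T α)).toAdd * (z - b) ∧
      ∀ j, (s j * t ^ p j) • T α • z = T (α + (0, Pi.single j 1)) • z := by
    refine Eventually.and (Ioo_mem_nhdsLT h.lt) ?_
    rw [eventually_all_finite (finite_norm_le J R)]
    intro α _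
    refine (h.eventually_eq (T α)).and ?_
    rw [eventually_all]
    intro j
    simp only [← mul_smul]
    refine h.eventually_smul_eq_smul (Multiplicative.toAdd.injective ?_)
    rw [map_mul, toAdd_mul, hslope, hslope, map_mul, toAdd_mul, map_zpow, toAdd_zpow]
    simp [add_mul, Finset.sum_add_distrib, Pi.single_apply, hℓ]
    ring
  -- `t` and `p` depend on `Λ` only, so `k` may be chosen after the region where all germs are linear.
  obtain ⟨k, hkc, hkd, hksub, hkΛ⟩ := hΛ _ hev
  refine ⟨t, p, T, k, ?_, fun m α => ?_, fun α hα j z hz => ((hksub hz).2 α hα).2 j,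
    fun α β hα hβ hne z hz hmem => ?_⟩
  · simp [hT]
  · simp [hT, add_comm α.1 m, zpow_add, mul_assoc]
  · set y := (T α)⁻¹ • T β • z with hy
    have hTy : T α • y = T β • z := by rw [hy, smul_inv_smul]
    have hyα := ((hksub hmem).2 α hα).1
    have hzβ := ((hksub hz).2 β hβ).1
    have hpos : ∀ x ∈ Icc (k • c) (k • d), Real.log (b - (k • d : unitInterval)) ≤
        Real.log (b - (x : ℝ)) ∧ Real.log (b - (x : ℝ)) ≤ Real.log (b - (k • c : unitInterval)) ∧
        0 < (b : ℝ) - x := by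
      intro x hx
      have h1 : ((k • d : unitInterval) : ℝ) < b := hkd.2
      have h2 : (x : ℝ) ≤ (k • d : unitInterval) := hx.2
      have h3 : ((k • c : unitInterval) : ℝ) ≤ x := hx.1
      exact ⟨Real.log_le_log (by linarith) (by linarith),
        Real.log_le_log (by linarith) (by linarith), by linarith⟩
    obtain ⟨hy1, hy2, hy3⟩ := hpos y hmem
    obtain ⟨hz1, hz2, hz3⟩ := hpos z hz
    rw [hTy, hzβ] at hyα
    have hlog : (h.logSlope (T α)).toAdd + Real.log (b - y) =
        (h.logSlope (T β)).toAdd + Real.log (b - z) := by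
      rw [← Real.log_exp (h.logSlope (T α)).toAdd, ← Real.log_exp (h.logSlope (T β)).toAdd,
        ← Real.log_mul (Real.exp_pos _).ne' hy3.ne', ← Real.log_mul (Real.exp_pos _).ne' hz3.ne']
      congr 1
      linarith
    have hsub : ‖α - β‖ ≤ (2 * R : ℕ) := by
      push_cast
      linarith [norm_sub_le α β]
    have hbd := abs_le_of_norm_le hsub
    have hlarge := hp (α - β).1 (α - β).2 hbd.1 hbd.2 (by
      by_contra! h0
      exact hne (sub_eq_zero.1 (Prod.ext h0.1 h0.2)))
    have hdiff : ((α - β).1 : ℝ) * ℓ + ∑ j, ((α - β).2 j : ℝ) *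
        ((h.logSlope (s j)).toAdd + p j * ℓ) =
        (h.logSlope (T α)).toAdd - (h.logSlope (T β)).toAdd := by
      rw [hslope, hslope]
      simp [sub_mul, Finset.sum_sub_distrib]
      ring
    rw [hdiff] at hlarge
    refine absurd hlarge (not_lt.2 ((abs_le.2 ⟨?_, ?_⟩).trans (le_abs_self Λ))) <;> linarith

end Sites

/-! ### Generating sets without short relations -/

section FormalReading

variable {J : Type*} [Fintype J] [DecidableEq J]

/-- The steps of the letters `t = none` and `z j = some j` in the lattice of positions
`ℤ × (J → ℤ)`: they are the basis vectors. -/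
def latticeStep : Option J → ℤ × (J → ℤ)
  | none => (1, 0)
  | some j => (0, Pi.single j 1)

/-- The letter `t` reads nothing, and `z j` reads the position at distance `M j` below its starting
point, in the direction of `t`. -/
def latticeRead (M : J → ℤ) : Option J → ℤ × (J → ℤ) → FreeGroup (ℤ × (J → ℤ))
  | none => fun _ => 1
  | some j => fun α => FreeGroup.of (α + (-M j, 0))

theorem norm_latticeStep_le (s : Option J) : ‖latticeStep s‖ ≤ 1 := by
  cases s with
  | none => simp [latticeStep, Prod.norm_def]
  | some j => simp [latticeStep, Prod.norm_def, Pi.norm_single]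

/-- If the shifts `M j` are far apart, then the position read by `z j` near the origin determines
both `j` and the `t`-coordinate at which it was read. So a short nontrivial word that returns to its
starting position reads a nontrivial word. -/
theorem latticeRead_ne_one {M : J → ℤ} {N : ℕ} (hM : ∀ i j, |M i - M j| ≤ 2 * N → i = j)
    (L : List (Option J × Bool)) (hL : L.length ≤ N) (hne : FreeGroup.mk L ≠ 1)
    (hpos : (readWord latticeStep (latticeRead M) L 0).1 = 0) :
    (readWord latticeStep (latticeRead M) L 0).2 ≠ 1 := by
  classical
  intro hR
  -- `κ` recovers the letter and its position from what is read near the origin.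
  obtain ⟨κ, hκ⟩ : ∃ κ : ℤ → Option J × ℤ,
      ∀ j, ∀ n : ℤ, |n| ≤ N → κ (n - M j) = (some j, n) := by
    refine ⟨fun m => if h : ∃ q : J × ℤ, |q.2| ≤ N ∧ q.2 - M q.1 = m then
      (some h.choose.1, h.choose.2) else (none, 0), fun j n hn => ?_⟩
    have h : ∃ q : J × ℤ, |q.2| ≤ N ∧ q.2 - M q.1 = n - M j := ⟨(j, n), hn, rfl⟩
    obtain ⟨h1, h2⟩ := h.choose_spec
    have h3 : h.choose.1 = j := hM _ _ (by
      rw [show M h.choose.1 - M j = h.choose.2 - n by linarith]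
      exact (abs_sub _ _).trans (by linarith))
    rw [h3] at h2
    simp only [h, dite_true, h3]
    rw [show h.choose.2 = n by linarith]
  have hmap := readWord_map (fun α : ℤ × (J → ℤ) => κ α.1) (d := latticeStep)
    (r := latticeRead M) (N := N)
    (r' := fun s α => s.elim 1 fun j => FreeGroup.of (some j, α.1)) norm_latticeStep_le
    (fun s α hα => by
      cases s with
      | none => simp [latticeRead]
      | some j =>
        simp only [latticeRead, FreeGroup.map.of, Prod.fst_add, ← sub_eq_add_neg]
        rw [hκ j α.1 (abs_le_of_norm_le hα).1]
        rfl) 0 L (by simpa using hL)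
  rw [hpos, hR, map_one] at hmap
  refine hne (mk_eq_one_of_readWord_eq (AddMonoidHom.fst ℤ (J → ℤ)) (i := none)
    (d := latticeStep) (r := fun s α => s.elim 1 fun j => FreeGroup.of (some j, α.1))
    norm_latticeStep_le rfl (fun s hs => ?_) (fun _ => rfl) (fun s hs α => ?_) 0 L ?_ ?_)
  · obtain ⟨j, rfl⟩ := Option.ne_none_iff_exists'.1 hs
    rfl
  · obtain ⟨j, rfl⟩ := Option.ne_none_iff_exists'.1 hs
    rfl
  · rw [hmap]
  · rw [hmap]

end FormalReading

/-- In a finitely generated group with nonsolvable action on an orbital there are, for every `N`,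
generating families without relations of length at most `N`, consisting of `t` and, for each `j`, of
`z j = x j * t ^ M j * u * t ^ (-M j)`. -/
theorem exists_generators_without_short_relations {Γ : Subgroup PLo} {a b : unitInterval}
    (hΓ : Γ.FG) (h : IsOrbital Γ a b)
    (hder : ∀ n, ∃ x ∈ Ioo a b, ∃ g ∈ iterDerived n Γ, g • x ≠ x)
    {J : Type} [Finite J] (s : J → Γ) (hs : Subgroup.closure (Set.range s) = ⊤) {j₀ : J}
    (hj₀ : s j₀ = 1) (N : ℕ) :
    ∃ g : Option J → Γ, Subgroup.closure (Set.range g) = ⊤ ∧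
      ∀ L : List (Option J × Bool), L.length ≤ N → FreeGroup.mk L ≠ 1 →
        FreeGroup.lift g (FreeGroup.mk L) ≠ 1 := by
  classical
  have := Fintype.ofFinite J
  set code := Fintype.equivFin J
  set M : J → ℤ := fun j => (2 * N + 1) * (code j : ℕ) with hMdef
  set R : ℕ := N + (2 * N + 1) * Fintype.card J with hR
  have hM : ∀ i j, |M i - M j| ≤ 2 * N → i = j := by
    intro i j hij
    by_contra hne
    have hcode : ((code i : ℕ) : ℤ) - (code j : ℕ) ≠ 0 := fun h0 =>
      hne (code.injective (Fin.ext (by exact_mod_cast sub_eq_zero.1 h0)))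
    have h1 := Int.one_le_abs hcode
    have h2 : M i - M j = (2 * N + 1) * ((code i : ℕ) - (code j : ℕ)) := by
      rw [hMdef]
      ring
    have h3 : (0 : ℤ) ≤ 2 * N + 1 := by positivity
    rw [h2, abs_mul, abs_of_nonneg h3] at hij
    nlinarith
  have hMR : ∀ j, ∀ α : ℤ × (J → ℤ), ‖α‖ ≤ N → ‖α + (-M j, 0)‖ ≤ R := by
    intro j α hα
    refine (norm_add_le _ _).trans ?_
    rw [hR, Nat.cast_add]
    refine add_le_add hα ?_
    have h1 : (code j : ℕ) ≤ Fintype.card J := (code j).2.le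
    have h2 : M j ≤ ((2 * N + 1) * Fintype.card J : ℕ) := by
      rw [hMdef]
      push_cast
      exact mul_le_mul_of_nonneg_left (by exact_mod_cast h1) (by positivity)
    have h3 : 0 ≤ M j := by
      rw [hMdef]
      positivity
    rw [Prod.norm_def]
    refine max_le ?_ (norm_zero.le.trans (Nat.cast_nonneg _))
    rw [norm_neg, Int.norm_eq_abs, abs_of_nonneg (by exact_mod_cast h3)]
    exact_mod_cast h2
  -- The nontrivial words read from the short words that return to their starting position.
  set Q : Finset (FreeGroup (ℤ × (J → ℤ))) :=
    ((List.finite_length_le (Option J × Bool) N).toFinset.image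
      fun L => (readWord latticeStep (latticeRead M) L 0).2).erase 1 with hQ
  obtain ⟨c, hc, d, hd, hcd, η₀, hη₀Γ, hη₀s, hη₀x⟩ :=
    exists_forall_lift_smul_ne h hder Q (by simp [hQ])
  obtain ⟨t, p, T, k, hT0, hTt, hTx, hTdisj⟩ := h.exists_sites hΓ hc hd hcd s R
  have hkc := h.smul_mem k.2 hc
  have hkd := h.smul_mem k.2 hd
  set C := Icc (k • c) (k • d) with hC
  set η : ℤ × (J → ℤ) → Γ := fun α => k * ⟨η₀ α, hη₀Γ α⟩ * k⁻¹ with hη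
  set B := (finite_norm_le J R).toFinset with hB
  have hsupp : ∀ α, SuppIn a b (k • c) (k • d) (η α : PLo) := fun α =>
    (hη₀s α).conj h k.2
  set u : Γ := ⟨siteProd B (fun α => (T α : PLo)) fun α => (η α : PLo),
    siteProd_mem (fun α _ => (T α).2) fun α _ => (η α).2⟩ with hu
  have husmul : ∀ α, ‖α‖ ≤ R → ∀ z ∈ C, u • T α • z = T α • η α • z := by
    intro α hα z hz
    exact siteProd_smul h hkc hkd (T := fun α => (T α : PLo)) (φ := fun α => (η α : PLo))
      (fun α _ => (T α).2) (fun α _ => (η α).2) (fun α _ => hsupp α)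
      (fun α hα β hβ hne z hz => hTdisj α β (by simpa [hB] using hα) (by simpa [hB] using hβ)
        hne z hz) (by simpa [hB] using hα) hz
  have hCη : ∀ w, ∀ z ∈ C, FreeGroup.lift η w • z ∈ C := by
    intro w z hz
    have h1 : (FreeGroup.lift η w : PLo) = FreeGroup.lift (fun α => (η α : PLo)) w :=
      DFunLike.congr_fun (FreeGroup.ext_hom (Γ.subtype.comp (FreeGroup.lift η))
        (FreeGroup.lift fun α => (η α : PLo)) fun α => by simp) w
    have h2 := SuppIn.lift hsupp w
    rw [← h1] at h2
    exact h2.smul_mem h hkc hkd (FreeGroup.lift η w).2 hz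
  set g : Option J → Γ := fun o => o.elim t fun j =>
    s j * t ^ p j * (t ^ M j * u * (t ^ M j)⁻¹) with hg
  refine ⟨g, ?_, fun L hL hne heq => ?_⟩
  · set K := Subgroup.closure (Set.range g)
    have ht : t ∈ K := Subgroup.subset_closure ⟨none, rfl⟩
    have hz : ∀ j, s j * t ^ p j * (t ^ M j * u * (t ^ M j)⁻¹) ∈ K := fun j =>
      Subgroup.subset_closure ⟨some j, rfl⟩
    have htn : ∀ n : ℤ, t ^ n ∈ K := fun n => K.zpow_mem ht n
    -- As `s j₀ = 1`, the generator `z j₀` is `u` up to powers of `t`.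
    have hu : u ∈ K := by
      have h1 := hz j₀
      rw [hj₀, one_mul, K.mul_mem_cancel_left (htn _),
        K.mul_mem_cancel_right (K.inv_mem (htn _)), K.mul_mem_cancel_left (htn _)] at h1
      exact h1
    rw [eq_top_iff, ← hs, Subgroup.closure_le]
    rintro _ ⟨j, rfl⟩
    have h1 := hz j
    rwa [K.mul_mem_cancel_right
      (K.mul_mem (K.mul_mem (htn _) hu) (K.inv_mem (htn _))), K.mul_mem_cancel_right (htn _)] at h1
  · have hread := fun z hz => lift_smul_eq_readWord (g := g) (d := latticeStep)
      (r := latticeRead M) (T := T) (η := η) (C := C) (N := N) norm_latticeStep_le hCη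
      (fun o α hα z hz => by
        cases o with
        | none =>
          have h1 := hTt 1 α
          rw [zpow_one] at h1
          simp only [latticeStep, latticeRead, map_one, one_smul, h1, mul_smul]
          rfl
        | some j =>
          have hβ := hMR j α hα
          have hTα : T (α + (-M j, 0)) = (t ^ M j)⁻¹ * T α := by rw [hTt, zpow_neg]
          have hz' : η (α + (-M j, 0)) • z ∈ C := by
            simpa using hCη (FreeGroup.of (α + (-M j, 0))) z hz
          have h1 := husmul _ hβ z hz
          have h2 := hTx α (hα.trans (by rw [hR]; push_cast; nlinarith)) j _ hz'
          rw [hTα, mul_smul, mul_smul] at h1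
          simp only [latticeStep, latticeRead, FreeGroup.lift_apply_of]
          rw [← h2]
          simp only [hg, Option.elim, mul_smul]
          rw [h1, smul_inv_smul])
      0 L (by simpa using hL) (z := z) hz
    have hCne : k • c ∈ C := ⟨le_rfl, (PLo.smul_le_smul_iff (k : PLo)).2 hcd⟩
    simp only [heq, hT0, one_smul] at hread
    -- A trivial word does not move `C` to another site.
    have hpos : (readWord latticeStep (latticeRead M) L 0).1 = 0 := by
      by_contra hpos
      have h1 := norm_readWord_fst_le norm_latticeStep_le (latticeRead M) 0 L
      have h2 : (L.length : ℝ) ≤ N := by exact_mod_cast hL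
      rw [norm_zero, zero_add] at h1
      refine hTdisj _ 0 ((h1.trans h2).trans (by rw [hR]; push_cast; nlinarith)) (by simp) hpos
        _ hCne ?_
      rw [hT0, one_smul]
      rw [inv_smul_eq_iff.2 (hread _ hCne)]
      exact hCη _ _ hCne
    have hR1 := latticeRead_ne_one hM L hL hne hpos
    obtain ⟨x, hx, hxne⟩ := hη₀x _ (Finset.mem_erase.2 ⟨hR1, Finset.mem_image_of_mem _
      ((List.finite_length_le (Option J × Bool) N).mem_toFinset.2 hL)⟩)
    have hconj : ∀ w, (FreeGroup.lift η w : PLo) = k * FreeGroup.lift η₀ w * (k : PLo)⁻¹ :=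
      DFunLike.congr_fun (FreeGroup.ext_hom (Γ.subtype.comp (FreeGroup.lift η))
        ((MulAut.conj (k : PLo)).toMonoidHom.comp (FreeGroup.lift η₀)) fun α => by simp [hη])
    have h1 := hread (k • x) ⟨(PLo.smul_le_smul_iff (k : PLo)).2 hx.1,
      (PLo.smul_le_smul_iff (k : PLo)).2 hx.2⟩
    rw [hpos, hT0, one_smul, Subgroup.smul_def, Subgroup.smul_def, hconj, mul_smul, mul_smul,
      inv_smul_smul] at h1
    exact hxne (smul_left_cancel _ h1).symm

/-! ### The girth alternative -/

open Classical in
/-- It suffices to exclude short relations among the members of a family with range `S`, even if the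
family has repetitions: words in the letters `S` are lifted along a section. -/
theorem le_girthOn {G σ : Type*} [Group G] {S : Finset G} {g : σ → G}
    (hS : (S : Set G) = Set.range g) {N : ℕ}
    (h : ∀ L : List (σ × Bool), L.length ≤ N → FreeGroup.mk L ≠ 1 →
      FreeGroup.lift g (FreeGroup.mk L) ≠ 1) : (N : ℕ∞) ≤ girthOn S := by
  refine le_iInf fun w => le_iInf fun hw => le_iInf fun hw1 => ?_
  by_contra! hlt
  have hsec : ∀ x : S, ∃ o, g o = x := fun x => by
    have : (x : G) ∈ (S : Set G) := x.2
    rwa [hS] at this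
  choose j hj using hsec
  have hjinj : Function.Injective j := fun x y hxy => Subtype.ext (by rw [← hj x, ← hj y, hxy])
  have hmap : FreeGroup.map j w = FreeGroup.mk (w.toWord.map fun p => (j p.1, p.2)) := by
    rw [← FreeGroup.map.mk, FreeGroup.mk_toWord]
  refine h (w.toWord.map fun p => (j p.1, p.2)) ?_ ?_ ?_
  · rw [List.length_map]
    exact le_of_lt (by exact_mod_cast hlt)
  · rw [← hmap]
    exact fun h1 => hw (FreeGroup.map_injective hjinj (h1.trans (map_one _).symm))
  · rw [← hmap, ← hw1]
    refine DFunLike.congr_fun (FreeGroup.ext_hom ((FreeGroup.lift g).comp (FreeGroup.map j)) _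
      fun x => ?_) w
    simp [hj]

theorem theorem1 (Γ : Subgroup PLo) (hΓ : Γ.FG) :
    Group.IsSolvable Γ ∨ groupGirth Γ = ⊤ := by
  classical
  refine or_iff_not_imp_left.2 fun hsol => ?_
  obtain ⟨a, b, hab, hder⟩ := exists_isOrbital_of_not_isSolvable hΓ hsol
  obtain ⟨S₀, hS₀⟩ := (Group.fg_iff_subgroup_fg Γ).2 hΓ |>.out
  refine ENat.eq_top_iff_forall_ge.2 fun N => ?_
  have hs : Subgroup.closure (Set.range fun o : Option S₀ => o.elim 1 fun x => (x : Γ)) = ⊤ := by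
    rw [eq_top_iff, ← hS₀]
    exact Subgroup.closure_mono fun x hx => ⟨some ⟨x, hx⟩, rfl⟩
  obtain ⟨g, hgen, hg⟩ := exists_generators_without_short_relations hΓ hab hder _ hs
    (j₀ := none) rfl N
  have hrange : ((Set.finite_range g).toFinset : Set Γ) = Set.range g := Set.Finite.coe_toFinset _
  exact (le_girthOn hrange hg).trans
    (le_iSup₂_of_le (Set.finite_range g).toFinset (by rw [hrange, hgen]) le_rfl)
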